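/- **Setting.** A *(unital commutative homotopy) probability space* is a cochain complex $(V,d)$ of complex vector spaces (graded by $\mathbb Z$, $d$ of degree $+1$) with an associative, graded commutative product with unit $1\in V^0$, $d1=0$, and a chain map $E:(V,d)\to(\mathbb C,0)$ (the expectation; $\mathbb C$ in degree $0$) with $E(1)=1$. No compatibility of $d$ or $E$ with the product is assumed. It is *contractible* if $E$ is a quasi-isomorphism. For a graded vector space $V$ let $SV=\bigoplus_{k\ge1}S^kV$ be the cofree nilpotent graded commutative coalgebra on $V$. If $V$ is a graded commutative algebra, let $\varphi:SV\to SV$ be the unique coalgebra automorphism whose component $SV\to V$ is $a_1\odot\cdots\odot a_k\mapsto a_1\cdots a_k$. A linear map $f:SV\to SW$, for graded commutative algebras $V,W$, is transported to $f^\varphi=\varphi^{-1}f\varphi$. For a probability space $V$, write $d$ also for the coderivation of $SV$ extending $d$ and $E:SV\to S\mathbb C$ for the coalgebra map induced by $E$; the transported structure is $d^\varphi$ and the total cumulant is $K=E^\varphi:SV\to S\mathbb C$. A *collection of $n$ homotopy random variables* in $V$ is an $L_\infty$ morphism $X:(\mathbb C^{n},0)\to(V,d^\varphi)$ ($\mathbb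 C^n$ in degree $0$), i.e. a degree zero coalgebra map $X:S\mathbb C^{n}\to SV$ with $d^\varphi X=0$. Its *joint cumulant* is the composition $KX:S\mathbb C^n\to S\mathbb C$. Two collections $X,Y$ are *homotopic* if there is an $L_\infty$ morphism $H:S\mathbb C^n\to SV\otimes\mathbb C[t,dt]$ (a degree zero map, compatible with the coproduct of $SV\otimes\mathbb C[t,dt]$ as a coalgebra over $\mathbb C[t,dt]$ and with $(d^\varphi\otimes1+1\otimes d_{\mathrm{dR}})H=0$, where $d_{\mathrm{dR}}$ is the differential of $\mathbb C[t,dt]$) with $H(0)=X$ and $H(1)=Y$. **Proposition.** Let $V$ be a contractible probability space and $n\ge0$. Two collections $X,Y$ of $n$ homotopy random variables in $V$ are homotopic if and only if their joint cumulants are equal: $KX=KY$. -/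

import Mathlib

set_option linter.unusedSectionVars false

noncomputable section

namespace HPT

open scoped DirectSum TensorProduct

variable {V : Type*} [AddCommGroup V] [Module ℂ V] 

/-- For a graded vector space `V`, the map `v ↦ (-1)^(p |v|) v`. -/
def signTwist (𝒱 : ℤ → Submodule ℂ V) [DirectSum.Decomposition 𝒱] (p : ℤ) : V →ₗ[ℂ] V :=
  DirectSum.toModule ℂ ℤ V (fun i => ((-1 : ℂ) ^ (p * i)) • (𝒱 i).subtype) ∘ₗ
    (DirectSum.decomposeLinearEquiv 𝒱).toLinearMap

theorem signTwist_of_mem (𝒱 : ℤ → Submodule ℂ V) [DirectSum.Decomposition 𝒱] (p : ℤ) {i : ℤ}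
    {v : V} (hv : v ∈ 𝒱 i) : signTwist 𝒱 p v = ((-1 : ℂ) ^ (p * i)) • v := by
  lift v to 𝒱 i using hv
  simp [signTwist]

theorem hom_ext_mem (𝒱 : ℤ → Submodule ℂ V) [DirectSum.Decomposition 𝒱] {W : Type*}
    [AddCommGroup W] [Module ℂ W] {f g : V →ₗ[ℂ] W} (h : ∀ i, ∀ v ∈ 𝒱 i, f v = g v) : f = g := by
  ext v
  induction v using DirectSum.Decomposition.inductionOn 𝒱 with
  | zero => simp
  | homogeneous m => exact h _ _ m.2
  | add a b ha hb => simp [ha, hb]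

/-- The relations `a ⊙ b = (-1)^(|a| |b|) b ⊙ a` for homogeneous `a, b`. -/
inductive GSym.Rel (𝒱 : ℤ → Submodule ℂ V) : TensorAlgebra ℂ V → TensorAlgebra ℂ V → Prop
  | comm {i j : ℤ} {a b : V} (ha : a ∈ 𝒱 i) (hb : b ∈ 𝒱 j) :
    GSym.Rel 𝒱 (TensorAlgebra.ι ℂ a * TensorAlgebra.ι ℂ b)
      (((-1 : ℂ) ^ (i * j)) • (TensorAlgebra.ι ℂ b * TensorAlgebra.ι ℂ a))

/-- The graded symmetric algebra of a graded vector space `V`: the sum of all graded symmetric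
powers `S^k V`, `k ≥ 0`. Its product is written `⊙` in comments. -/
def GSym (𝒱 : ℤ → Submodule ℂ V) : Type _ := RingQuot (GSym.Rel 𝒱)

namespace GSym

instance (𝒱 : ℤ → Submodule ℂ V) : Ring (GSym 𝒱) :=
  inferInstanceAs (Ring (RingQuot (GSym.Rel 𝒱)))

instance (𝒱 : ℤ → Submodule ℂ V) : Algebra ℂ (GSym 𝒱) :=
  inferInstanceAs (Algebra ℂ (RingQuot (GSym.Rel 𝒱)))

/-- The quotient map from the tensor algebra. -/
def mk (𝒱 : ℤ → Submodule ℂ V) : TensorAlgebra ℂ V →ₐ[ℂ] GSym 𝒱 :=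
  RingQuot.mkAlgHom ℂ (GSym.Rel 𝒱)

/-- The inclusion of `V` as the first symmetric power. -/
def ι (𝒱 : ℤ → Submodule ℂ V) : V →ₗ[ℂ] GSym 𝒱 :=
  (mk 𝒱).toLinearMap ∘ₗ TensorAlgebra.ι ℂ

theorem ι_comm (𝒱 : ℤ → Submodule ℂ V) {i j : ℤ} {a b : V} (ha : a ∈ 𝒱 i) (hb : b ∈ 𝒱 j) :
    ι 𝒱 a * ι 𝒱 b = ((-1 : ℂ) ^ (i * j)) • (ι 𝒱 b * ι 𝒱 a) := by
  have := RingQuot.mkAlgHom_rel ℂ (Rel.comm ha hb)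
  rw [map_mul, map_smul, map_mul] at this
  exact this

/-- The universal property of the graded symmetric algebra. -/
def lift (𝒱 : ℤ → Submodule ℂ V) {A : Type*} [Ring A] [Algebra ℂ A] (f : V →ₗ[ℂ] A)
    (hf : ∀ i j, ∀ a ∈ 𝒱 i, ∀ b ∈ 𝒱 j, f a * f b = ((-1 : ℂ) ^ (i * j)) • (f b * f a)) :
    GSym 𝒱 →ₐ[ℂ] A :=
  RingQuot.liftAlgHom ℂ ⟨TensorAlgebra.lift ℂ f, by
    rintro x y ⟨ha, hb⟩
    simpa using hf _ _ _ ha _ hb⟩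

@[simp]
theorem lift_ι (𝒱 : ℤ → Submodule ℂ V) {A : Type*} [Ring A] [Algebra ℂ A] (f : V →ₗ[ℂ] A)
    (hf : ∀ i j, ∀ a ∈ 𝒱 i, ∀ b ∈ 𝒱 j, f a * f b = ((-1 : ℂ) ^ (i * j)) • (f b * f a)) (v : V) :
    lift 𝒱 f hf (ι 𝒱 v) = f v := by
  have := RingQuot.liftAlgHom_mkAlgHom_apply (s := Rel 𝒱) ℂ (TensorAlgebra.lift ℂ f)
    (by rintro x y ⟨ha, hb⟩; simpa using hf _ _ _ ha _ hb) (TensorAlgebra.ι ℂ v)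
  rw [TensorAlgebra.lift_ι_apply] at this
  exact this

theorem hom_ext (𝒱 : ℤ → Submodule ℂ V) {A : Type*} [Ring A] [Algebra ℂ A]
    {f g : GSym 𝒱 →ₐ[ℂ] A} (h : ∀ v, f (ι 𝒱 v) = g (ι 𝒱 v)) : f = g := by
  apply RingQuot.ringQuot_ext'
  apply TensorAlgebra.hom_ext
  ext v
  exact h v

theorem eq_top_of_cons (𝒱 : ℤ → Submodule ℂ V) [DirectSum.Decomposition 𝒱]
    (p : Submodule ℂ (GSym 𝒱)) (h1 : 1 ∈ p)
    (hc : ∀ i, ∀ v ∈ 𝒱 i, ∀ x ∈ p, ι 𝒱 v * x ∈ p) : p = ⊤ := by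
  have hc' : ∀ v, ∀ x ∈ p, ι 𝒱 v * x ∈ p := by
    intro v x hx
    induction v using DirectSum.Decomposition.inductionOn 𝒱 with
    | zero => simp
    | homogeneous m => exact hc _ _ m.2 x hx
    | add a b ha hb => rw [map_add, add_mul]; exact p.add_mem ha hb
  rw [eq_top_iff]
  rintro x -
  obtain ⟨y, rfl⟩ : ∃ y, mk 𝒱 y = x := RingQuot.mkAlgHom_surjective ℂ (GSym.Rel 𝒱) x
  suffices ∀ z ∈ p, mk 𝒱 y * z ∈ p by
    simpa using this 1 h1
  induction y using TensorAlgebra.induction with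
  | algebraMap r => intro z hz; rw [AlgHom.commutes, ← Algebra.smul_def]; exact p.smul_mem r hz
  | ι v => intro z hz; exact hc' v z hz
  | mul a b ha hb => intro z hz; rw [map_mul, mul_assoc]; exact ha _ (hb _ hz)
  | add a b ha hb => intro z hz; rw [map_add, add_mul]; exact p.add_mem (ha _ hz) (hb _ hz)

theorem lhom_ext_cons (𝒱 : ℤ → Submodule ℂ V) [DirectSum.Decomposition 𝒱]
    {W : Type*} [AddCommGroup W] [Module ℂ W] {f g : GSym 𝒱 →ₗ[ℂ] W} (h1 : f 1 = g 1)
    (hc : ∀ i, ∀ v ∈ 𝒱 i, ∀ x, f x = g x → f (ι 𝒱 v * x) = g (ι 𝒱 v * x)) : f = g := by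
  have := eq_top_of_cons 𝒱 (LinearMap.eqLocus f g) h1 hc
  ext x
  have hx : x ∈ LinearMap.eqLocus f g := by rw [this]; trivial
  exact hx

/-- The internal grading: `v₁ ⊙ ⋯ ⊙ vₙ` has degree `|v₁| + ⋯ + |vₙ|`. -/
def degree (𝒱 : ℤ → Submodule ℂ V) (k : ℤ) : Submodule ℂ (GSym 𝒱) :=
  Submodule.span ℂ {x | ∃ l : List (ℤ × V), (∀ q ∈ l, q.2 ∈ 𝒱 q.1) ∧
    (l.map Prod.fst).sum = k ∧ x = (l.map fun q => ι 𝒱 q.2).prod}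

theorem ι_mem_degree (𝒱 : ℤ → Submodule ℂ V) {i : ℤ} {v : V} (hv : v ∈ 𝒱 i) :
    ι 𝒱 v ∈ degree 𝒱 i :=
  Submodule.subset_span ⟨[(i, v)], by simpa using hv, by simp, by simp⟩

instance (𝒱 : ℤ → Submodule ℂ V) : SetLike.GradedMonoid (degree 𝒱) where
  one_mem := Submodule.subset_span ⟨[], by simp, by simp, by simp⟩
  mul_mem := by
    intro i j x y hx hy
    have : degree 𝒱 i * degree 𝒱 j ≤ degree 𝒱 (i + j) := by
      rw [degree, degree, Submodule.span_mul_span, Submodule.span_le]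
      rintro _ ⟨_, ⟨l, hl, hli, rfl⟩, _, ⟨m, hm, hmj, rfl⟩, rfl⟩
      refine Submodule.subset_span ⟨l ++ m, ?_, by simp [hli, hmj], by simp⟩
      intro q hq
      rcases List.mem_append.1 hq with h | h
      exacts [hl q h, hm q h]
    exact this (Submodule.mul_mem_mul hx hy)

/-- The inclusion of `V`, as a map into the direct sum of the graded pieces. -/
def toDegree (𝒱 : ℤ → Submodule ℂ V) [DirectSum.Decomposition 𝒱] :
    V →ₗ[ℂ] ⨁ k, degree 𝒱 k :=
  DirectSum.toModule ℂ ℤ _ (fun i => DirectSum.lof ℂ ℤ (fun k => degree 𝒱 k) i ∘ₗ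
    (ι 𝒱).restrict (fun _ hv => ι_mem_degree 𝒱 hv)) ∘ₗ
    (DirectSum.decomposeLinearEquiv 𝒱).toLinearMap

theorem toDegree_of_mem (𝒱 : ℤ → Submodule ℂ V) [DirectSum.Decomposition 𝒱] {i : ℤ} {v : V}
    (hv : v ∈ 𝒱 i) :
    toDegree 𝒱 v = DirectSum.of (fun k => degree 𝒱 k) i ⟨ι 𝒱 v, ι_mem_degree 𝒱 hv⟩ := by
  lift v to 𝒱 i using hv
  simp only [toDegree, LinearMap.comp_apply, LinearEquiv.coe_coe,
    DirectSum.decomposeLinearEquiv_apply, DirectSum.decompose_coe]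
  rw [← DirectSum.lof_eq_of ℂ, DirectSum.toModule_lof]
  rfl

/-- The decomposition of the graded symmetric algebra by internal degree. -/
def decomposeHom (𝒱 : ℤ → Submodule ℂ V) [DirectSum.Decomposition 𝒱] :
    GSym 𝒱 →ₐ[ℂ] ⨁ k, degree 𝒱 k :=
  lift 𝒱 (A := ⨁ k, degree 𝒱 k) (toDegree 𝒱) (by
    intro i j a ha b hb
    rw [toDegree_of_mem 𝒱 ha, toDegree_of_mem 𝒱 hb, DirectSum.of_mul_of, DirectSum.of_mul_of,
      ← DirectSum.lof_eq_of ℂ, ← DirectSum.lof_eq_of ℂ, ← map_smul,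
      DirectSum.lof_eq_of, DirectSum.lof_eq_of]
    exact DirectSum.of_eq_of_gradedMonoid_eq (Sigma.subtype_ext (add_comm _ _) (ι_comm 𝒱 ha hb)))

theorem decomposeHom_of_mem (𝒱 : ℤ → Submodule ℂ V) [DirectSum.Decomposition 𝒱] (k : ℤ)
    (x : degree 𝒱 k) : decomposeHom 𝒱 x = DirectSum.of (fun k => degree 𝒱 k) k x := by
  obtain ⟨x, hx⟩ := x
  induction hx using Submodule.span_induction with
  | mem x hx =>
    obtain ⟨l, hl, hk, rfl⟩ := hx
    induction l generalizing k with
    | nil =>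
      subst hk
      simp only [List.map_nil, List.prod_nil, map_one]
      rfl
    | cons q l ih =>
      have hq : q.2 ∈ 𝒱 q.1 := hl q (by simp)
      simp only [List.map_cons, List.prod_cons, map_mul]
      rw [ih _ (fun r hr => hl r (by simp [hr])) rfl, decomposeHom, lift_ι,
        toDegree_of_mem 𝒱 hq, DirectSum.of_mul_of]
      exact DirectSum.of_eq_of_gradedMonoid_eq (Sigma.subtype_ext
        (by exact (by simpa using hk : q.1 + (l.map Prod.fst).sum = k)) rfl)
  | zero =>
    simp only [map_zero]
    exact (map_zero (DirectSum.of (fun k => degree 𝒱 k) k)).symm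
  | add a b ha hb h1 h2 =>
    simp only [map_add, h1, h2]
    rw [← map_add]; rfl
  | smul c a ha h =>
    simp only [map_smul, h]
    rw [← DirectSum.lof_eq_of ℂ, ← map_smul]; rfl

instance (𝒱 : ℤ → Submodule ℂ V) [DirectSum.Decomposition 𝒱] : GradedAlgebra (degree 𝒱) :=
  GradedAlgebra.ofAlgHom _ (decomposeHom 𝒱)
    (by
      apply hom_ext
      intro v
      simp only [AlgHom.comp_apply, decomposeHom, lift_ι, AlgHom.id_apply]
      induction v using DirectSum.Decomposition.inductionOn 𝒱 with
      | zero => simp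
      | homogeneous m => rw [toDegree_of_mem 𝒱 m.2, DirectSum.coeAlgHom_of]
      | add a b ha hb => simp [ha, hb])
    (decomposeHom_of_mem 𝒱)

end GSym

namespace GSym

variable (𝒱 : ℤ → Submodule ℂ V) [DirectSum.Decomposition 𝒱]

theorem units_smul {M : Type*} [AddCommGroup M] [Module ℂ M] (n : ℤ) (x : M) :
    ((-1 : ℤˣ) ^ n) • x = ((-1 : ℂ) ^ n) • x := by
  rcases Int.even_or_odd n with h | h
  · simp [h.neg_one_zpow]
  · simp [h.neg_one_zpow]

open GradedTensorProduct in
theorem comul_rel {i j : ℤ} {a b : V} (ha : a ∈ 𝒱 i) (hb : b ∈ 𝒱 j) :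
    ((ι 𝒱 a) ᵍ⊗ₜ[ℂ] 1 + 1 ᵍ⊗ₜ[ℂ] (ι 𝒱 a) : degree 𝒱 ᵍ⊗[ℂ] degree 𝒱) *
      ((ι 𝒱 b) ᵍ⊗ₜ[ℂ] 1 + 1 ᵍ⊗ₜ[ℂ] (ι 𝒱 b)) =
    ((-1 : ℂ) ^ (i * j)) • (((ι 𝒱 b) ᵍ⊗ₜ[ℂ] 1 + 1 ᵍ⊗ₜ[ℂ] (ι 𝒱 b)) *
      ((ι 𝒱 a) ᵍ⊗ₜ[ℂ] 1 + 1 ᵍ⊗ₜ[ℂ] (ι 𝒱 a))) := by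
  have h1 := tmul_coe_mul_coe_tmul (R := ℂ) (degree 𝒱) (degree 𝒱) 1
    ⟨ι 𝒱 a, ι_mem_degree 𝒱 ha⟩ ⟨ι 𝒱 b, ι_mem_degree 𝒱 hb⟩ 1
  have h2 := tmul_coe_mul_coe_tmul (R := ℂ) (degree 𝒱) (degree 𝒱) 1
    ⟨ι 𝒱 b, ι_mem_degree 𝒱 hb⟩ ⟨ι 𝒱 a, ι_mem_degree 𝒱 ha⟩ 1
  have h3 := tmul_one_mul_coe_tmul (R := ℂ) (degree 𝒱) (degree 𝒱) (ι 𝒱 a)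
    ⟨ι 𝒱 b, ι_mem_degree 𝒱 hb⟩ 1
  have h4 := tmul_one_mul_coe_tmul (R := ℂ) (degree 𝒱) (degree 𝒱) (ι 𝒱 b)
    ⟨ι 𝒱 a, ι_mem_degree 𝒱 ha⟩ 1
  have h5 := tmul_coe_mul_one_tmul (R := ℂ) (degree 𝒱) (degree 𝒱) 1
    ⟨ι 𝒱 a, ι_mem_degree 𝒱 ha⟩ (ι 𝒱 b)
  have h6 := tmul_coe_mul_one_tmul (R := ℂ) (degree 𝒱) (degree 𝒱) 1
    ⟨ι 𝒱 b, ι_mem_degree 𝒱 hb⟩ (ι 𝒱 a)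
  have h7 := tmul_one_mul_one_tmul (R := ℂ) (degree 𝒱) (degree 𝒱) (ι 𝒱 a) (ι 𝒱 b)
  have h8 := tmul_one_mul_one_tmul (R := ℂ) (degree 𝒱) (degree 𝒱) (ι 𝒱 b) (ι 𝒱 a)
  simp only [one_mul, mul_one] at h1 h2 h3 h4 h5 h6
  rw [units_smul] at h1 h2
  simp only [mul_add, add_mul, h1, h2, h3, h4, h5, h6, h7, h8, ι_comm 𝒱 ha hb, smul_add]
  have hs : ((-1 : ℂ) ^ (i * j)) * ((-1 : ℂ) ^ (j * i)) = 1 := by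
    rw [mul_comm j i, ← zpow_add₀ (by norm_num)]
    exact (Even.add_self (i * j)).neg_one_zpow
  have e1 : ∀ (c : ℂ) (x y : GSym 𝒱),
      ((c • x) ᵍ⊗ₜ[ℂ] y : degree 𝒱 ᵍ⊗[ℂ] degree 𝒱) = c • (x ᵍ⊗ₜ[ℂ] y) := by
    intro c x y
    rw [tmul, ← TensorProduct.smul_tmul', map_smul]
  have e2 : ∀ (c : ℂ) (x y : GSym 𝒱),
      (x ᵍ⊗ₜ[ℂ] (c • y) : degree 𝒱 ᵍ⊗[ℂ] degree 𝒱) = c • (x ᵍ⊗ₜ[ℂ] y) := by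
    intro c x y
    rw [tmul, TensorProduct.tmul_smul, map_smul]
  simp only [e1, e2, smul_smul, hs, one_smul]
  abel

/-- The coproduct as an algebra map to the graded tensor product (with the sign rule in its product),
determined by `v ↦ v ⊗ 1 + 1 ⊗ v`. On `v₁ ⊙ ⋯ ⊙ vₙ` it is the sum over all unshuffles with Koszul signs. -/
def comulHom : GSym 𝒱 →ₐ[ℂ] (degree 𝒱 ᵍ⊗[ℂ] degree 𝒱) :=
  lift 𝒱 (A := degree 𝒱 ᵍ⊗[ℂ] degree 𝒱)
    (((GradedTensorProduct.includeLeft (R := ℂ) (degree 𝒱) (degree 𝒱)).toLinearMap +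
      (GradedTensorProduct.includeRight (R := ℂ) (degree 𝒱) (degree 𝒱)).toLinearMap) ∘ₗ ι 𝒱)
    (by
      intro i j a ha b hb
      simp only [LinearMap.comp_apply, LinearMap.add_apply, AlgHom.toLinearMap_apply,
        GradedTensorProduct.includeLeft_apply, GradedTensorProduct.includeRight_apply]
      exact comul_rel 𝒱 ha hb)

theorem comulHom_ι (v : V) : comulHom 𝒱 (ι 𝒱 v) =
    GradedTensorProduct.tmul ℂ (ι 𝒱 v) 1 + GradedTensorProduct.tmul ℂ 1 (ι 𝒱 v) := by
  rw [comulHom, lift_ι]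
  rfl

/-- The coproduct of the graded symmetric algebra. -/
def comul : GSym 𝒱 →ₗ[ℂ] GSym 𝒱 ⊗[ℂ] GSym 𝒱 :=
  (GradedTensorProduct.of ℂ (degree 𝒱) (degree 𝒱)).symm.toLinearMap ∘ₗ (comulHom 𝒱).toLinearMap

/-- The counit: the projection onto `S^0 V = ℂ`. -/
def counit (𝒱 : ℤ → Submodule ℂ V) : GSym 𝒱 →ₐ[ℂ] ℂ := lift 𝒱 0 (by simp)

/-- Auxiliary to `proj`: `v` acts on `ℂ × V` by `(c, w) ↦ (0, c v)`. -/
def projHom (𝒱 : ℤ → Submodule ℂ V) : GSym 𝒱 →ₐ[ℂ] Module.End ℂ (ℂ × V) :=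
  lift 𝒱
    { toFun := fun v => LinearMap.inr ℂ ℂ V ∘ₗ (LinearMap.toSpanSingleton ℂ V v) ∘ₗ
        LinearMap.fst ℂ ℂ V
      map_add' := by intro v w; ext <;> simp
      map_smul' := by intro c v; ext <;> simp }
    (by intros; ext <;> simp)

/-- The projection onto the first symmetric power. -/
def proj (𝒱 : ℤ → Submodule ℂ V) : GSym 𝒱 →ₗ[ℂ] V :=
  LinearMap.snd ℂ ℂ V ∘ₗ LinearMap.applyₗ ((1, 0) : ℂ × V) ∘ₗ (projHom 𝒱).toLinearMap

@[simp] theorem counit_ι (v : V) : counit 𝒱 (ι 𝒱 v) = 0 := by simp [counit]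

theorem projHom_inr (x : GSym 𝒱) (c : ℂ) : (projHom 𝒱 x (c, 0)).1 = c * counit 𝒱 x := by
  have : LinearMap.fst ℂ ℂ V ∘ₗ LinearMap.applyₗ ((c, 0) : ℂ × V) ∘ₗ (projHom 𝒱).toLinearMap
      = c • (counit 𝒱).toLinearMap := by
    apply lhom_ext_cons 𝒱
    · simp
    · intro i v hv x hx
      simp [projHom]
  exact LinearMap.congr_fun this x

@[simp] theorem proj_one : proj 𝒱 1 = 0 := by simp [proj]

@[simp] theorem proj_ι_mul (v : V) (x : GSym 𝒱) : proj 𝒱 (ι 𝒱 v * x) = counit 𝒱 x • v := by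
  have := projHom_inr 𝒱 x 1
  simp only [one_mul] at this
  simp only [proj, LinearMap.comp_apply, AlgHom.toLinearMap_apply, map_mul,
    LinearMap.applyₗ_apply_apply, Module.End.mul_apply]
  rw [← this]
  simp [projHom]

@[simp] theorem proj_ι (v : V) : proj 𝒱 (ι 𝒱 v) = v := by
  simpa using proj_ι_mul 𝒱 v 1

theorem signTwist_ι_mul {q : ℤ} (p : ℤ) {u : V} (hu : u ∈ 𝒱 q) (x : GSym 𝒱) :
    signTwist (degree 𝒱) p (ι 𝒱 u * x) =
      ((-1 : ℂ) ^ (p * q)) • (ι 𝒱 u * signTwist (degree 𝒱) p x) := by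
  suffices signTwist (degree 𝒱) p ∘ₗ LinearMap.mulLeft ℂ (ι 𝒱 u) =
      ((-1 : ℂ) ^ (p * q)) • LinearMap.mulLeft ℂ (ι 𝒱 u) ∘ₗ signTwist (degree 𝒱) p from
    LinearMap.congr_fun this x
  apply hom_ext_mem (degree 𝒱)
  intro i v hv
  have := SetLike.GradedMul.mul_mem (A := degree 𝒱) (ι_mem_degree 𝒱 hu) hv
  simp only [LinearMap.comp_apply, LinearMap.mulLeft_apply, LinearMap.smul_apply,
    signTwist_of_mem _ _ this, signTwist_of_mem _ _ hv, mul_smul_comm, smul_smul]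
  rw [mul_add, zpow_add₀ (by norm_num)]

@[simp] theorem signTwist_one (p : ℤ) : signTwist (degree 𝒱) p 1 = 1 := by
  rw [signTwist_of_mem (degree 𝒱) p (SetLike.GradedOne.one_mem)]; simp

theorem comul_one : comul 𝒱 1 = 1 ⊗ₜ 1 := by
  simp [comul, ← Algebra.TensorProduct.one_def]

/-- `(u ⊗ 1 + 1 ⊗ u) (a ⊗ b)` for `u` homogeneous of degree `q`. -/
def consTensor (q : ℤ) (u : V) : GSym 𝒱 ⊗[ℂ] GSym 𝒱 →ₗ[ℂ] GSym 𝒱 ⊗[ℂ] GSym 𝒱 :=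
  TensorProduct.map (LinearMap.mulLeft ℂ (ι 𝒱 u)) LinearMap.id +
    TensorProduct.map (signTwist (degree 𝒱) q) (LinearMap.mulLeft ℂ (ι 𝒱 u))

theorem comul_ι_mul {q : ℤ} {u : V} (hu : u ∈ 𝒱 q) (x : GSym 𝒱) :
    comul 𝒱 (ι 𝒱 u * x) = consTensor 𝒱 q u (comul 𝒱 x) := by
  have key : ∀ y : degree 𝒱 ᵍ⊗[ℂ] degree 𝒱,
      (GradedTensorProduct.of ℂ (degree 𝒱) (degree 𝒱)).symm (comulHom 𝒱 (ι 𝒱 u) * y) =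
      consTensor 𝒱 q u ((GradedTensorProduct.of ℂ (degree 𝒱) (degree 𝒱)).symm y) := by
    intro y
    obtain ⟨y, rfl⟩ := (GradedTensorProduct.of ℂ (degree 𝒱) (degree 𝒱)).surjective y
    rw [GradedTensorProduct.of_symm_of]
    induction y using TensorProduct.induction_on with
    | zero => simp
    | add a b ha hb => simp only [map_add, mul_add, ha, hb]
    | tmul a b =>
      induction a using DirectSum.Decomposition.inductionOn (degree 𝒱) with
      | zero => simp
      | add a a' ha hb => simp only [TensorProduct.add_tmul, map_add, mul_add, ha, hb]
      | @homogeneous i m =>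
        have h1 := GradedTensorProduct.tmul_coe_mul_coe_tmul (R := ℂ) (degree 𝒱) (degree 𝒱) 1
          ⟨ι 𝒱 u, ι_mem_degree 𝒱 hu⟩ m b
        have h2 := GradedTensorProduct.tmul_one_mul_coe_tmul (R := ℂ) (degree 𝒱) (degree 𝒱)
          (ι 𝒱 u) m b
        simp only [one_mul] at h1
        rw [units_smul] at h1
        rw [comulHom_ι, add_mul, h1, h2, map_add, map_smul]
        simp [consTensor, signTwist_of_mem (degree 𝒱) q m.2, TensorProduct.smul_tmul']
  simp only [comul, LinearMap.comp_apply, AlgHom.toLinearMap_apply, map_mul]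
  exact key _

end GSym
namespace GSym

variable (𝒱 : ℤ → Submodule ℂ V) [DirectSum.Decomposition 𝒱]

theorem counit_signTwist (p : ℤ) (x : GSym 𝒱) :
    counit 𝒱 (signTwist (degree 𝒱) p x) = counit 𝒱 x := by
  suffices (counit 𝒱).toLinearMap ∘ₗ signTwist (degree 𝒱) p = (counit 𝒱).toLinearMap from
    LinearMap.congr_fun this x
  apply lhom_ext_cons 𝒱
  · simp
  · intro i v hv x hx
    simp [signTwist_ι_mul 𝒱 p hv]

theorem proj_signTwist (p : ℤ) (x : GSym 𝒱) :
    proj 𝒱 (signTwist (degree 𝒱) p x) = signTwist 𝒱 p (proj 𝒱 x) := by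
  suffices proj 𝒱 ∘ₗ signTwist (degree 𝒱) p = signTwist 𝒱 p ∘ₗ proj 𝒱 from
    LinearMap.congr_fun this x
  apply lhom_ext_cons 𝒱
  · simp
  · intro i v hv x hx
    simp [signTwist_ι_mul 𝒱 p hv, counit_signTwist, signTwist_of_mem 𝒱 p hv, smul_smul, mul_comm]

theorem lcounit_comul (x : GSym 𝒱) :
    TensorProduct.lid ℂ _ (TensorProduct.map (counit 𝒱).toLinearMap LinearMap.id (comul 𝒱 x)) = x := by
  suffices (TensorProduct.lid ℂ _).toLinearMap ∘ₗ
      (TensorProduct.map (counit 𝒱).toLinearMap LinearMap.id) ∘ₗ comul 𝒱 = LinearMap.id from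
    LinearMap.congr_fun this x
  apply lhom_ext_cons 𝒱
  · simp [comul_one]
  · intro i v hv x hx
    have key : (TensorProduct.lid ℂ _).toLinearMap ∘ₗ
      (TensorProduct.map (counit 𝒱).toLinearMap LinearMap.id) ∘ₗ consTensor 𝒱 i v =
      LinearMap.mulLeft ℂ (ι 𝒱 v) ∘ₗ (TensorProduct.lid ℂ _).toLinearMap ∘ₗ
      (TensorProduct.map (counit 𝒱).toLinearMap LinearMap.id) := by
      ext a b
      simp [consTensor, counit_signTwist]
    have := LinearMap.congr_fun key (comul 𝒱 x)
    simp only [LinearMap.comp_apply, LinearMap.id_apply] at this hx ⊢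
    rw [comul_ι_mul 𝒱 hv, this, hx]
    simp

/-- The coderivation with the single component `g : V → V`, namely `x ↦ ∑ g(x₁) ⊙ x₂`, where the
sum runs over the coproduct of `x` and `g` is applied to the length one part of `x₁`. That is,
`v₁ ⊙ ⋯ ⊙ vₙ ↦ ∑ᵢ ± v₁ ⊙ ⋯ ⊙ g vᵢ ⊙ ⋯ ⊙ vₙ` (see `coderiv_ι_mul`). -/
def coderiv (g : V →ₗ[ℂ] V) : GSym 𝒱 →ₗ[ℂ] GSym 𝒱 :=
  LinearMap.mul' ℂ (GSym 𝒱) ∘ₗ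
    TensorProduct.map (ι 𝒱 ∘ₗ g ∘ₗ proj 𝒱) LinearMap.id ∘ₗ comul 𝒱

theorem coderiv_add (g h : V →ₗ[ℂ] V) : coderiv 𝒱 (g + h) = coderiv 𝒱 g + coderiv 𝒱 h := by
  simp only [coderiv, LinearMap.add_comp, LinearMap.comp_add, TensorProduct.map_add_left]

theorem coderiv_smul (c : ℂ) (g : V →ₗ[ℂ] V) : coderiv 𝒱 (c • g) = c • coderiv 𝒱 g := by
  simp only [coderiv, LinearMap.smul_comp, LinearMap.comp_smul, TensorProduct.map_smul_left]

theorem coderiv_one (g : V →ₗ[ℂ] V) : coderiv 𝒱 g 1 = 0 := by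
  simp [coderiv, comul_one]

theorem coderiv_ι_mul {g : V →ₗ[ℂ] V} {p q : ℤ} (hg : ∀ i, ∀ v ∈ 𝒱 i, g v ∈ 𝒱 (i + p)) {u : V}
    (hu : u ∈ 𝒱 q) (x : GSym 𝒱) : coderiv 𝒱 g (ι 𝒱 u * x) =
      ι 𝒱 (g u) * x + ((-1 : ℂ) ^ (p * q)) • (ι 𝒱 u * coderiv 𝒱 g x) := by
  have h1 : ∀ w : V, ι 𝒱 (g (signTwist 𝒱 q w)) * ι 𝒱 u =
      ((-1 : ℂ) ^ (p * q)) • (ι 𝒱 u * ι 𝒱 (g w)) := by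
    intro w
    induction w using DirectSum.Decomposition.inductionOn 𝒱 with
    | zero => simp
    | add a b ha hb => simp only [map_add, add_mul, mul_add, smul_add, ha, hb]
    | @homogeneous i m =>
      rw [signTwist_of_mem 𝒱 q m.2, map_smul, map_smul, smul_mul_assoc,
        ι_comm 𝒱 (hg _ _ m.2) hu, smul_smul, ← zpow_add₀ (by norm_num)]
      congr 1
      have : q * i + (i + p) * q = (q * i + q * i) + p * q := by ring
      rw [this, zpow_add₀ (by norm_num), (Even.add_self (q * i)).neg_one_zpow, one_mul]
  have key : LinearMap.mul' ℂ (GSym 𝒱) ∘ₗ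
      TensorProduct.map (ι 𝒱 ∘ₗ g ∘ₗ proj 𝒱) LinearMap.id ∘ₗ consTensor 𝒱 q u =
      LinearMap.mulLeft ℂ (ι 𝒱 (g u)) ∘ₗ (TensorProduct.lid ℂ _).toLinearMap ∘ₗ
        (TensorProduct.map (counit 𝒱).toLinearMap LinearMap.id) +
      ((-1 : ℂ) ^ (p * q)) • LinearMap.mulLeft ℂ (ι 𝒱 u) ∘ₗ LinearMap.mul' ℂ (GSym 𝒱) ∘ₗ
        TensorProduct.map (ι 𝒱 ∘ₗ g ∘ₗ proj 𝒱) LinearMap.id := by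
    ext a b
    simp only [consTensor, TensorProduct.AlgebraTensorModule.curry_apply, LinearMap.restrictScalars_self,
      TensorProduct.curry_apply, LinearMap.comp_apply, LinearMap.add_apply,
      TensorProduct.map_tmul, LinearMap.mulLeft_apply, LinearMap.id_apply, map_add,
      LinearMap.mul'_apply, proj_ι_mul, proj_signTwist, LinearMap.smul_apply, LinearEquiv.coe_coe,
      TensorProduct.lid_tmul, AlgHom.toLinearMap_apply]
    rw [← mul_assoc, h1]
    simp [mul_assoc]
  have := LinearMap.congr_fun key (comul 𝒱 x)
  simp only [LinearMap.comp_apply, LinearMap.add_apply, LinearMap.smul_apply,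
    LinearEquiv.coe_coe, lcounit_comul, LinearMap.mulLeft_apply] at this
  simp only [coderiv, LinearMap.comp_apply]
  rw [comul_ι_mul 𝒱 hu, this]

theorem counit_coderiv (g : V →ₗ[ℂ] V) (x : GSym 𝒱) : counit 𝒱 (coderiv 𝒱 g x) = 0 := by
  suffices (counit 𝒱).toLinearMap ∘ₗ (LinearMap.mul' ℂ (GSym 𝒱) ∘ₗ
    TensorProduct.map (ι 𝒱 ∘ₗ g ∘ₗ proj 𝒱) LinearMap.id) = 0 from
    LinearMap.congr_fun this (comul 𝒱 x)
  ext a b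
  simp

end GSym

/-- A graded algebra is graded commutative if `a b = (-1)^(|a| |b|) b a` for homogeneous `a, b`. -/
class GradedCommutative {A : Type*} [Ring A] [Algebra ℂ A] (𝒜 : ℤ → Submodule ℂ A) : Prop where
  mul_comm' : ∀ i j, ∀ a ∈ 𝒜 i, ∀ b ∈ 𝒜 j, a * b = ((-1 : ℂ) ^ (i * j)) • (b * a)

namespace GSym

variable {A : Type*} [Ring A] [Algebra ℂ A] (𝒜 : ℤ → Submodule ℂ A)

/-- The algebra map `a₁ ⊙ ⋯ ⊙ aₙ ↦ a₁ ⋯ aₙ`. -/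
def mulMap [GradedCommutative 𝒜] : GSym 𝒜 →ₐ[ℂ] A :=
  lift 𝒜 LinearMap.id (fun i j a ha b hb => GradedCommutative.mul_comm' i j a ha b hb)

variable [GradedAlgebra 𝒜]

/-- The operator `v₁ ⊙ ⋯ ⊙ vₙ ↦ v ⊙ v₁ ⊙ ⋯ ⊙ vₙ + ∑ᵢ ± v₁ ⊙ ⋯ ⊙ (v vᵢ) ⊙ ⋯ ⊙ vₙ`. -/
def insert : A →ₗ[ℂ] Module.End ℂ (GSym 𝒜) :=
  { toFun := fun v => LinearMap.mulLeft ℂ (ι 𝒜 v) + coderiv 𝒜 (LinearMap.mulLeft ℂ v)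
    map_add' := by
      intro v w
      have : LinearMap.mulLeft ℂ (v + w) = LinearMap.mulLeft ℂ v + LinearMap.mulLeft ℂ w := by
        ext; simp [add_mul]
      rw [this, coderiv_add]
      ext x
      simp only [LinearMap.add_apply, LinearMap.mulLeft_apply, map_add, add_mul]
      abel
    map_smul' := by
      intro c v
      have : LinearMap.mulLeft ℂ (c • v) = c • LinearMap.mulLeft ℂ v := by
        ext; simp
      rw [this, coderiv_smul]
      ext x
      simp }

theorem insert_one (v : A) : insert 𝒜 v 1 = ι 𝒜 v := by
  simp [insert, coderiv_one]

theorem insert_ι_mul {p q : ℤ} {v u : A} (hv : v ∈ 𝒜 p) (hu : u ∈ 𝒜 q) (x : GSym 𝒜) :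
    insert 𝒜 v (ι 𝒜 u * x) = ι 𝒜 (v * u) * x +
      ((-1 : ℂ) ^ (p * q)) • (ι 𝒜 u * insert 𝒜 v x) := by
  have hg : ∀ i, ∀ w ∈ 𝒜 i, LinearMap.mulLeft ℂ v w ∈ 𝒜 (i + p) := by
    intro i w hw
    rw [add_comm]
    exact SetLike.GradedMul.mul_mem hv hw
  simp only [insert, LinearMap.coe_mk, AddHom.coe_mk, LinearMap.add_apply,
    LinearMap.mulLeft_apply, coderiv_ι_mul 𝒜 hg hu, mul_add, smul_add]
  rw [← mul_assoc, ι_comm 𝒜 hv hu, smul_mul_assoc, mul_assoc]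
  abel

theorem insert_comm [GradedCommutative 𝒜] {p q : ℤ} {v u : A} (hv : v ∈ 𝒜 p) (hu : u ∈ 𝒜 q) :
    insert 𝒜 v * insert 𝒜 u = ((-1 : ℂ) ^ (p * q)) • (insert 𝒜 u * insert 𝒜 v) := by
  have hs : ((-1 : ℂ) ^ (p * q)) * ((-1 : ℂ) ^ (p * q)) = 1 := by
    rw [← zpow_add₀ (by norm_num)]
    exact (Even.add_self (p * q)).neg_one_zpow
  have huv := GradedCommutative.mul_comm' p q v hv u hu
  apply lhom_ext_cons 𝒜
  · simp only [Module.End.mul_apply, LinearMap.smul_apply, insert_one]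
    rw [← mul_one (ι 𝒜 u), ← mul_one (ι 𝒜 v), insert_ι_mul 𝒜 hv hu, insert_ι_mul 𝒜 hu hv,
      insert_one, insert_one, huv, mul_comm q p]
    simp only [map_smul, smul_add, smul_mul_assoc, mul_one, smul_smul, hs, one_smul]
    rw [ι_comm 𝒜 hu hv, smul_smul, mul_comm q p, hs, one_smul]
  · intro r w hw x hx
    simp only [Module.End.mul_apply, LinearMap.smul_apply] at hx ⊢
    have huw : u * w ∈ 𝒜 (q + r) := SetLike.GradedMul.mul_mem hu hw
    have hvw : v * w ∈ 𝒜 (p + r) := SetLike.GradedMul.mul_mem hv hw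
    rw [insert_ι_mul 𝒜 hv hw, insert_ι_mul 𝒜 hu hw, map_add, map_add, map_smul, map_smul,
      insert_ι_mul 𝒜 hv hw, insert_ι_mul 𝒜 hu hw, insert_ι_mul 𝒜 hv huw, insert_ι_mul 𝒜 hu hvw, hx,
      ← mul_assoc v, huv, ← mul_assoc u]
    simp only [map_smul, smul_add, smul_mul_assoc, mul_smul_comm, smul_smul, mul_add]
    have e1 : ((-1 : ℂ) ^ (p * q + p * r)) = (-1) ^ (p * q) * (-1) ^ (p * r) := by
      rw [zpow_add₀ (by norm_num)]
    have e2 : ((-1 : ℂ) ^ (p * q)) * ((-1 : ℂ) ^ (q * p + q * r)) = (-1) ^ (q * r) := by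
      rw [zpow_add₀ (by norm_num), mul_comm q p, ← mul_assoc, hs, one_mul]
    rw [e1, e2]
    module

/-- The cumulant map on the graded symmetric algebra: `a₁ ⊙ ⋯ ⊙ aₙ` is sent to the sum over all
partitions of `{1, …, n}` of the `⊙`-product over the blocks of the products in `A`, with Koszul
signs. It is built up factor by factor: the new factor is a block of its own or joins a block. -/
def cumulantHom [GradedCommutative 𝒜] : GSym 𝒜 →ₗ[ℂ] GSym 𝒜 :=
  LinearMap.applyₗ (1 : GSym 𝒜) ∘ₗ
    (lift 𝒜 (insert 𝒜) (fun _ _ _ ha _ hb => insert_comm 𝒜 ha hb)).toLinearMap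

variable [GradedCommutative 𝒜]

@[simp] theorem cumulantHom_one : cumulantHom 𝒜 1 = 1 := by simp [cumulantHom]

theorem cumulantHom_ι_mul (v : A) (x : GSym 𝒜) :
    cumulantHom 𝒜 (ι 𝒜 v * x) = insert 𝒜 v (cumulantHom 𝒜 x) := by
  simp [cumulantHom]

theorem signTwist_insert {p : ℤ} (q : ℤ) {v : A} (hv : v ∈ 𝒜 p) (x : GSym 𝒜) :
    signTwist (degree 𝒜) q (insert 𝒜 v x) =
      ((-1 : ℂ) ^ (p * q)) • insert 𝒜 v (signTwist (degree 𝒜) q x) := by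
  suffices signTwist (degree 𝒜) q ∘ₗ insert 𝒜 v =
      ((-1 : ℂ) ^ (p * q)) • (insert 𝒜 v ∘ₗ signTwist (degree 𝒜) q) from
    LinearMap.congr_fun this x
  apply lhom_ext_cons 𝒜
  · simp [insert_one, signTwist_of_mem (degree 𝒜) q (ι_mem_degree 𝒜 hv), mul_comm]
  · intro r u hu x hx
    simp only [LinearMap.comp_apply, LinearMap.smul_apply] at hx ⊢
    rw [insert_ι_mul 𝒜 hv hu, map_add, map_smul, signTwist_ι_mul 𝒜 q hu, signTwist_ι_mul 𝒜 q hu,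
      signTwist_ι_mul 𝒜 q (SetLike.GradedMul.mul_mem hv hu), hx, map_smul, insert_ι_mul 𝒜 hv hu]
    simp only [smul_add, smul_smul, mul_smul_comm]
    rw [mul_add, zpow_add₀ (by norm_num), mul_comm p q]
    module

theorem signTwist_cumulantHom (q : ℤ) (x : GSym 𝒜) :
    signTwist (degree 𝒜) q (cumulantHom 𝒜 x) = cumulantHom 𝒜 (signTwist (degree 𝒜) q x) := by
  suffices signTwist (degree 𝒜) q ∘ₗ cumulantHom 𝒜 =
      cumulantHom 𝒜 ∘ₗ signTwist (degree 𝒜) q from LinearMap.congr_fun this x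
  apply lhom_ext_cons 𝒜
  · simp
  · intro r u hu x hx
    simp only [LinearMap.comp_apply] at hx ⊢
    rw [cumulantHom_ι_mul, signTwist_insert 𝒜 q hu, hx, signTwist_ι_mul 𝒜 q hu, map_smul,
      cumulantHom_ι_mul, mul_comm]

/-- The action of the operator `insert v`, `|v| = p`, on both factors of a tensor product. -/
def insertTensor (p : ℤ) (v : A) : GSym 𝒜 ⊗[ℂ] GSym 𝒜 →ₗ[ℂ] GSym 𝒜 ⊗[ℂ] GSym 𝒜 :=
  TensorProduct.map (insert 𝒜 v) LinearMap.id +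
    TensorProduct.map (signTwist (degree 𝒜) p) (insert 𝒜 v)

theorem signTwist_signTwist (p q : ℤ) (x : GSym 𝒜) : signTwist (degree 𝒜) p
    (signTwist (degree 𝒜) q x) = signTwist (degree 𝒜) (p + q) x := by
  induction x using DirectSum.Decomposition.inductionOn (degree 𝒜) with
  | zero => simp
  | add a b ha hb => simp only [map_add, ha, hb]
  | homogeneous m =>
    simp only [signTwist_of_mem (degree 𝒜) _ m.2, map_smul, smul_smul]
    rw [add_mul, zpow_add₀ (by norm_num), mul_comm]

theorem comul_insert {p : ℤ} {v : A} (hv : v ∈ 𝒜 p) (x : GSym 𝒜) :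
    comul 𝒜 (insert 𝒜 v x) = insertTensor 𝒜 p v (comul 𝒜 x) := by
  suffices comul 𝒜 ∘ₗ insert 𝒜 v = insertTensor 𝒜 p v ∘ₗ comul 𝒜 from LinearMap.congr_fun this x
  apply lhom_ext_cons 𝒜
  · simp only [LinearMap.comp_apply, insert_one, comul_one]
    rw [← mul_one (ι 𝒜 v), comul_ι_mul 𝒜 hv, comul_one]
    simp [insertTensor, consTensor, insert_one]
  · intro q u hu x hx
    simp only [LinearMap.comp_apply] at hx ⊢
    have hvu : v * u ∈ 𝒜 (p + q) := SetLike.GradedMul.mul_mem hv hu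
    rw [insert_ι_mul 𝒜 hv hu, map_add, map_smul, comul_ι_mul 𝒜 hu, comul_ι_mul 𝒜 hu,
      comul_ι_mul 𝒜 hvu, hx]
    have key : insertTensor 𝒜 p v ∘ₗ consTensor 𝒜 q u = consTensor 𝒜 (p + q) (v * u) +
        ((-1 : ℂ) ^ (p * q)) • (consTensor 𝒜 q u ∘ₗ insertTensor 𝒜 p v) := by
      ext a b
      simp only [insertTensor, consTensor, TensorProduct.AlgebraTensorModule.curry_apply,
        LinearMap.restrictScalars_self, TensorProduct.curry_apply, LinearMap.comp_apply,
        LinearMap.add_apply, LinearMap.smul_apply, map_add, TensorProduct.map_tmul,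
        LinearMap.mulLeft_apply, LinearMap.id_apply, insert_ι_mul 𝒜 hv hu,
        signTwist_ι_mul 𝒜 p hu, signTwist_insert 𝒜 q hv, signTwist_signTwist, add_comm q p,
        TensorProduct.add_tmul, TensorProduct.tmul_add, TensorProduct.tmul_smul,
        ← TensorProduct.smul_tmul', smul_add, smul_smul]
      rw [← zpow_add₀ (by norm_num), (Even.add_self (p * q)).neg_one_zpow]
      module
    exact (LinearMap.congr_fun key (comul 𝒜 x)).symm

theorem comul_cumulantHom (x : GSym 𝒜) : comul 𝒜 (cumulantHom 𝒜 x) =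
    TensorProduct.map (cumulantHom 𝒜) (cumulantHom 𝒜) (comul 𝒜 x) := by
  suffices comul 𝒜 ∘ₗ cumulantHom 𝒜 =
    TensorProduct.map (cumulantHom 𝒜) (cumulantHom 𝒜) ∘ₗ comul 𝒜 from LinearMap.congr_fun this x
  apply lhom_ext_cons 𝒜
  · simp [comul_one]
  · intro q u hu x hx
    simp only [LinearMap.comp_apply] at hx ⊢
    rw [cumulantHom_ι_mul, comul_insert 𝒜 hu, hx, comul_ι_mul 𝒜 hu]
    have key : TensorProduct.map (cumulantHom 𝒜) (cumulantHom 𝒜) ∘ₗ consTensor 𝒜 q u =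
        insertTensor 𝒜 q u ∘ₗ TensorProduct.map (cumulantHom 𝒜) (cumulantHom 𝒜) := by
      ext a b
      simp [insertTensor, consTensor, cumulantHom_ι_mul, signTwist_cumulantHom]
    exact (LinearMap.congr_fun key (comul 𝒜 x)).symm

theorem counit_insert (v : A) (x : GSym 𝒜) : counit 𝒜 (insert 𝒜 v x) = 0 := by
  simp [insert, counit_coderiv]

theorem counit_cumulantHom (x : GSym 𝒜) : counit 𝒜 (cumulantHom 𝒜 x) = counit 𝒜 x := by
  suffices (counit 𝒜).toLinearMap ∘ₗ cumulantHom 𝒜 = (counit 𝒜).toLinearMap from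
    LinearMap.congr_fun this x
  apply lhom_ext_cons 𝒜
  · simp
  · intro q u hu x hx
    simp [cumulantHom_ι_mul, counit_insert]

theorem proj_insert {p : ℤ} {v : A} (hv : v ∈ 𝒜 p) (x : GSym 𝒜) :
    proj 𝒜 (insert 𝒜 v x) = counit 𝒜 x • v + v * proj 𝒜 x := by
  suffices proj 𝒜 ∘ₗ insert 𝒜 v = (LinearMap.toSpanSingleton ℂ A v) ∘ₗ (counit 𝒜).toLinearMap +
    LinearMap.mulLeft ℂ v ∘ₗ proj 𝒜 from LinearMap.congr_fun this x
  apply lhom_ext_cons 𝒜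
  · simp [insert_one]
  · intro q u hu x hx
    simp [insert_ι_mul 𝒜 hv hu, counit_insert]

theorem proj_cumulantHom (x : GSym 𝒜) :
    proj 𝒜 (cumulantHom 𝒜 x) = mulMap 𝒜 x - counit 𝒜 x • 1 := by
  suffices proj 𝒜 ∘ₗ cumulantHom 𝒜 = (mulMap 𝒜).toLinearMap -
    (LinearMap.toSpanSingleton ℂ A 1) ∘ₗ (counit 𝒜).toLinearMap from LinearMap.congr_fun this x
  apply lhom_ext_cons 𝒜
  · simp
  · intro q u hu x hx
    simp only [LinearMap.comp_apply, LinearMap.sub_apply, AlgHom.toLinearMap_apply,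
      LinearMap.toSpanSingleton_apply] at hx ⊢
    rw [cumulantHom_ι_mul, proj_insert 𝒜 hu, counit_cumulantHom, hx]
    simp [mulMap, mul_sub]

/-- The span of the `⊙`-products of fewer than `n` factors. -/
def wordLT (n : ℕ) : Submodule ℂ (GSym 𝒜) :=
  Submodule.span ℂ {x | ∃ l : List (ℤ × A), l.length < n ∧ (∀ q ∈ l, q.2 ∈ 𝒜 q.1) ∧
    x = (l.map fun q => ι 𝒜 q.2).prod}

theorem ι_mul_wordLT {n : ℕ} {i : ℤ} {v : A} (hv : v ∈ 𝒜 i) {x : GSym 𝒜} (hx : x ∈ wordLT 𝒜 n) :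
    ι 𝒜 v * x ∈ wordLT 𝒜 (n + 1) := by
  induction hx using Submodule.span_induction with
  | mem x hx =>
    obtain ⟨l, hl, h, rfl⟩ := hx
    exact Submodule.subset_span ⟨(i, v) :: l, by simpa using hl, by simpa using ⟨hv, by simpa using h⟩,
      by simp⟩
  | zero => simp
  | add a b _ _ ha hb => rw [mul_add]; exact add_mem ha hb
  | smul c a _ ha => rw [mul_smul_comm]; exact Submodule.smul_mem _ _ ha

theorem coderiv_mem_wordLT {g : A →ₗ[ℂ] A} {p : ℤ} (hg : ∀ i, ∀ v ∈ 𝒜 i, g v ∈ 𝒜 (i + p)) {n : ℕ}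
    {x : GSym 𝒜} (hx : x ∈ wordLT 𝒜 n) : coderiv 𝒜 g x ∈ wordLT 𝒜 n := by
  induction hx using Submodule.span_induction with
  | mem x hx =>
    obtain ⟨l, hl, h, rfl⟩ := hx
    induction l generalizing n with
    | nil => simp [coderiv_one]
    | cons q l ih =>
      obtain ⟨n, rfl⟩ : ∃ m, n = m + 1 := ⟨n - 1, by simp at hl; omega⟩
      have hq : q.2 ∈ 𝒜 q.1 := h q (by simp)
      have hl' : l.length < n := by simpa using hl
      have h' : ∀ r ∈ l, r.2 ∈ 𝒜 r.1 := fun r hr => h r (by simp [hr])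
      simp only [List.map_cons, List.prod_cons]
      rw [coderiv_ι_mul 𝒜 hg hq]
      refine add_mem (ι_mul_wordLT 𝒜 (hg _ _ hq) (Submodule.subset_span ⟨l, hl', h', rfl⟩))
        (Submodule.smul_mem _ _ (ι_mul_wordLT 𝒜 hq (ih hl' h')))
  | zero => simp
  | add a b _ _ ha hb => rw [map_add]; exact add_mem ha hb
  | smul c a _ ha => rw [map_smul]; exact Submodule.smul_mem _ _ ha

theorem wordLT_mono {m n : ℕ} (h : m ≤ n) : wordLT 𝒜 m ≤ wordLT 𝒜 n :=
  Submodule.span_mono fun _ ⟨l, hl, h1, h2⟩ => ⟨l, hl.trans_le h, h1, h2⟩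

theorem exists_mem_wordLT (x : GSym 𝒜) : ∃ n, x ∈ wordLT 𝒜 n := by
  have : (⨆ n, wordLT 𝒜 n) = ⊤ := by
    apply eq_top_of_cons 𝒜
    · exact Submodule.mem_iSup_of_mem 1 (Submodule.subset_span ⟨[], by simp, by simp, by simp⟩)
    · intro i v hv x hx
      rw [Submodule.mem_iSup_of_directed _ (monotone_nat_of_le_succ
        fun n => wordLT_mono 𝒜 (Nat.le_succ n)).directed_le] at hx ⊢
      obtain ⟨n, hn⟩ := hx
      exact ⟨n + 1, ι_mul_wordLT 𝒜 hv hn⟩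
  have hx : x ∈ (⨆ n, wordLT 𝒜 n) := by rw [this]; trivial
  rwa [Submodule.mem_iSup_of_directed _ (monotone_nat_of_le_succ
        fun n => wordLT_mono 𝒜 (Nat.le_succ n)).directed_le] at hx

theorem cumulantHom_sub_mem {n : ℕ} {x : GSym 𝒜} (hx : x ∈ wordLT 𝒜 (n + 1)) :
    cumulantHom 𝒜 x - x ∈ wordLT 𝒜 n := by
  induction hx using Submodule.span_induction with
  | mem x hx =>
    obtain ⟨l, hl, h, rfl⟩ := hx
    induction l generalizing n with
    | nil => simp
    | cons q l ih =>
      obtain ⟨n, rfl⟩ : ∃ m, n = m + 1 := ⟨n - 1, by simp at hl; omega⟩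
      have hq : q.2 ∈ 𝒜 q.1 := h q (by simp)
      have hl' : l.length < n + 1 := by simpa using hl
      have h' : ∀ r ∈ l, r.2 ∈ 𝒜 r.1 := fun r hr => h r (by simp [hr])
      have h1 := ih hl' h'
      have hg : ∀ i, ∀ w ∈ 𝒜 i, LinearMap.mulLeft ℂ q.2 w ∈ 𝒜 (i + q.1) := by
        intro i w hw
        rw [add_comm]
        exact SetLike.GradedMul.mul_mem hq hw
      simp only [List.map_cons, List.prod_cons]
      set y := (l.map fun q => ι 𝒜 q.2).prod
      have hy : y ∈ wordLT 𝒜 (n + 1) := Submodule.subset_span ⟨l, hl', h', rfl⟩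
      have h2 : cumulantHom 𝒜 y ∈ wordLT 𝒜 (n + 1) := by
        have := add_mem (wordLT_mono 𝒜 (Nat.le_succ n) h1) hy
        simpa using this
      have h3 := add_mem (ι_mul_wordLT 𝒜 hq h1) (coderiv_mem_wordLT 𝒜 hg h2)
      rw [cumulantHom_ι_mul]
      convert h3 using 1
      simp only [insert, LinearMap.coe_mk, AddHom.coe_mk, LinearMap.add_apply,
        LinearMap.mulLeft_apply, mul_sub]
      abel
  | zero => simp
  | add a b _ _ ha hb => rw [map_add, add_sub_add_comm]; exact add_mem ha hb
  | smul c a _ ha => rw [map_smul, ← smul_sub]; exact Submodule.smul_mem _ _ ha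

theorem wordLT_zero : wordLT 𝒜 0 = ⊥ := by simp [wordLT]

theorem cumulantHom_bijective : Function.Bijective (cumulantHom 𝒜) := by
  constructor
  · rw [injective_iff_map_eq_zero]
    intro x hx
    obtain ⟨n, hn⟩ := exists_mem_wordLT 𝒜 x
    induction n with
    | zero => simpa [wordLT_zero] using hn
    | succ n ih =>
      have := cumulantHom_sub_mem 𝒜 hn
      rw [hx, zero_sub, neg_mem_iff] at this
      exact ih this
  · intro x
    obtain ⟨n, hn⟩ := exists_mem_wordLT 𝒜 x
    induction n generalizing x with
    | zero => exact ⟨0, by simpa [wordLT_zero, eq_comm] using hn⟩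
    | succ n ih =>
      obtain ⟨y, hy⟩ := ih _ (cumulantHom_sub_mem 𝒜 hn)
      exact ⟨x - y, by rw [map_sub, hy, sub_sub_cancel]⟩

end GSym

namespace GSym

/-- The algebra map `a₁ ⊙ ⋯ ⊙ aₙ ↦ f a₁ ⊙ ⋯ ⊙ f aₙ` induced by a degree zero linear map. -/
def map {W : Type*} [AddCommGroup W] [Module ℂ W] (𝒱 : ℤ → Submodule ℂ V)
    (𝒲 : ℤ → Submodule ℂ W) (f : V →ₗ[ℂ] W) (hf : ∀ i, ∀ v ∈ 𝒱 i, f v ∈ 𝒲 i) :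
    GSym 𝒱 →ₐ[ℂ] GSym 𝒲 :=
  lift 𝒱 (ι 𝒲 ∘ₗ f) (fun i j a ha b hb => ι_comm 𝒲 (hf i a ha) (hf j b hb))

theorem counit_map {W : Type*} [AddCommGroup W] [Module ℂ W] (𝒱 : ℤ → Submodule ℂ V)
    (𝒲 : ℤ → Submodule ℂ W) (f : V →ₗ[ℂ] W) (hf : ∀ i, ∀ v ∈ 𝒱 i, f v ∈ 𝒲 i) (x : GSym 𝒱) :
    counit 𝒲 (map 𝒱 𝒲 f hf x) = counit 𝒱 x := by
  suffices (counit 𝒲).comp (map 𝒱 𝒲 f hf) = counit 𝒱 from AlgHom.congr_fun this x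
  apply hom_ext
  intro v
  simp [map, counit]

end GSym

/-- The symmetric coalgebra `SV`, i.e. the cofree nilpotent graded commutative coalgebra on `V`:
the sum of the graded symmetric powers `S^k V`, `k ≥ 1` (the augmentation ideal of the graded
symmetric algebra). -/
abbrev SymCoalg (𝒱 : ℤ → Submodule ℂ V) : Type _ :=
  LinearMap.ker (GSym.counit 𝒱).toLinearMap

namespace SymCoalg

/-- The projection of the graded symmetric algebra onto `SV` that kills the unit. -/
def reduce (𝒱 : ℤ → Submodule ℂ V) : GSym 𝒱 →ₗ[ℂ] SymCoalg 𝒱 :=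
  (LinearMap.id - Algebra.linearMap ℂ (GSym 𝒱) ∘ₗ (GSym.counit 𝒱).toLinearMap).codRestrict _
    (fun x => by simp)

/-- The reduced coproduct of `SV`. On `a₁ ⊙ ⋯ ⊙ aₙ` it is the sum over all `(k, n-k)`-unshuffles
with `0 < k < n`, with Koszul signs. -/
def comul (𝒱 : ℤ → Submodule ℂ V) [DirectSum.Decomposition 𝒱] :
    SymCoalg 𝒱 →ₗ[ℂ] SymCoalg 𝒱 ⊗[ℂ] SymCoalg 𝒱 :=
  TensorProduct.map (reduce 𝒱) (reduce 𝒱) ∘ₗ GSym.comul 𝒱 ∘ₗ Submodule.subtype _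

/-- The projection `SV → V` onto the first symmetric power. -/
def proj (𝒱 : ℤ → Submodule ℂ V) : SymCoalg 𝒱 →ₗ[ℂ] V :=
  GSym.proj 𝒱 ∘ₗ Submodule.subtype _

/-- The (internal) degree `k` part of `SV`. -/
def degree (𝒱 : ℤ → Submodule ℂ V) (k : ℤ) : Submodule ℂ (SymCoalg 𝒱) :=
  (GSym.degree 𝒱 k).comap (Submodule.subtype _)

/-- The parity involution `x ↦ (-1)^|x| x` of `SV`. -/
def parity (𝒱 : ℤ → Submodule ℂ V) [DirectSum.Decomposition 𝒱] :
    SymCoalg 𝒱 →ₗ[ℂ] SymCoalg 𝒱 :=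
  (signTwist (GSym.degree 𝒱) 1).restrict (fun x hx => by
    simpa [GSym.counit_signTwist] using hx)

/-- The map `Sf : SV → SW`, `a₁ ⊙ ⋯ ⊙ aₙ ↦ f a₁ ⊙ ⋯ ⊙ f aₙ`, induced by a degree zero linear map
`f : V → W`. -/
def map {W : Type*} [AddCommGroup W] [Module ℂ W] (𝒱 : ℤ → Submodule ℂ V)
    (𝒲 : ℤ → Submodule ℂ W) (f : V →ₗ[ℂ] W) (hf : ∀ i, ∀ v ∈ 𝒱 i, f v ∈ 𝒲 i) :
    SymCoalg 𝒱 →ₗ[ℂ] SymCoalg 𝒲 :=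
  (GSym.map 𝒱 𝒲 f hf).toLinearMap.restrict (fun x hx => by
    simpa [GSym.counit_map] using hx)

/-- The extension of a linear map `d : V → V` to a coderivation of `SV`:
`a₁ ⊙ ⋯ ⊙ aₙ ↦ ∑ᵢ ± a₁ ⊙ ⋯ ⊙ d aᵢ ⊙ ⋯ ⊙ aₙ`. -/
def extend (𝒱 : ℤ → Submodule ℂ V) [DirectSum.Decomposition 𝒱] (d : V →ₗ[ℂ] V) :
    SymCoalg 𝒱 →ₗ[ℂ] SymCoalg 𝒱 :=
  (GSym.coderiv 𝒱 d).restrict (fun x _ => by simpa using GSym.counit_coderiv 𝒱 d x)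

section Cumulant

variable {A B : Type*} [Ring A] [Algebra ℂ A] [Ring B] [Algebra ℂ B]

/-- The map `SA → A`, `a₁ ⊙ ⋯ ⊙ aₙ ↦ a₁ ⋯ aₙ`. -/
def mulMap (𝒜 : ℤ → Submodule ℂ A) [GradedCommutative 𝒜] : SymCoalg 𝒜 →ₗ[ℂ] A :=
  (GSym.mulMap 𝒜).toLinearMap ∘ₗ Submodule.subtype _

variable (𝒜 : ℤ → Submodule ℂ A) [GradedAlgebra 𝒜] [GradedCommutative 𝒜]
  (ℬ : ℤ → Submodule ℂ B) [GradedAlgebra ℬ] [GradedCommutative ℬ]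

/-- The cumulant map `φ : SA → SA`: the coalgebra automorphism whose component `SA → A` is
`a₁ ⊙ ⋯ ⊙ aₙ ↦ a₁ ⋯ aₙ` (see `isCoalgHom_cumulantMap` and `proj_cumulantMap`). -/
def cumulantMap : SymCoalg 𝒜 ≃ₗ[ℂ] SymCoalg 𝒜 :=
  LinearEquiv.ofBijective
    ((GSym.cumulantHom 𝒜).restrict (fun x hx => by
      simpa [GSym.counit_cumulantHom] using hx : ∀ x ∈ LinearMap.ker (GSym.counit 𝒜).toLinearMap,
        GSym.cumulantHom 𝒜 x ∈ LinearMap.ker (GSym.counit 𝒜).toLinearMap))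
    (by
      constructor
      · intro x y h
        exact Subtype.ext ((GSym.cumulantHom_bijective 𝒜).1 (congrArg Subtype.val h))
      · rintro ⟨x, hx⟩
        obtain ⟨y, rfl⟩ := (GSym.cumulantHom_bijective 𝒜).2 x
        exact ⟨⟨y, by simpa [GSym.counit_cumulantHom] using hx⟩, rfl⟩)

/-- A linear map `f : SA → SB` transported by the cumulant maps: `f^φ = φ⁻¹ f φ`. -/
def transport (f : SymCoalg 𝒜 →ₗ[ℂ] SymCoalg ℬ) : SymCoalg 𝒜 →ₗ[ℂ] SymCoalg ℬ :=
  (cumulantMap ℬ).symm.toLinearMap ∘ₗ f ∘ₗ (cumulantMap 𝒜).toLinearMap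

end Cumulant

end SymCoalg

section LInfinity

variable {W : Type*} [AddCommGroup W] [Module ℂ W]
variable (𝒱 : ℤ → Submodule ℂ V) [DirectSum.Decomposition 𝒱]
variable (𝒲 : ℤ → Submodule ℂ W) [DirectSum.Decomposition 𝒲]

/-- `F : SV → SW` is a map of coalgebras. -/
def IsCoalgHom (F : SymCoalg 𝒱 →ₗ[ℂ] SymCoalg 𝒲) : Prop :=
  SymCoalg.comul 𝒲 ∘ₗ F = TensorProduct.map F F ∘ₗ SymCoalg.comul 𝒱

/-- An `L∞` morphism from `(V, D)` to `(W, D')`, where the `L∞` structures are given by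
coderivations of the symmetric coalgebras: a degree zero coalgebra map `F : SV → SW` with
`D' F = F D`. -/
structure IsLInfinityMorphism (D : SymCoalg 𝒱 →ₗ[ℂ] SymCoalg 𝒱) (D' : SymCoalg 𝒲 →ₗ[ℂ] SymCoalg 𝒲)
    (F : SymCoalg 𝒱 →ₗ[ℂ] SymCoalg 𝒲) : Prop where
  coalg : IsCoalgHom 𝒱 𝒲 F
  degree_zero : ∀ k, ∀ x ∈ SymCoalg.degree 𝒱 k, F x ∈ SymCoalg.degree 𝒲 k
  comm : D' ∘ₗ F = F ∘ₗ D

end LInfinity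

theorem SymCoalg.isCoalgHom_cumulantMap {A : Type*} [Ring A] [Algebra ℂ A]
    (𝒜 : ℤ → Submodule ℂ A) [GradedAlgebra 𝒜] [GradedCommutative 𝒜] :
    IsCoalgHom 𝒜 𝒜 (SymCoalg.cumulantMap 𝒜).toLinearMap := by
  ext x
  have h1 : (SymCoalg.cumulantMap 𝒜).toLinearMap ∘ₗ SymCoalg.reduce 𝒜 =
      SymCoalg.reduce 𝒜 ∘ₗ GSym.cumulantHom 𝒜 := by
    ext y
    change GSym.cumulantHom 𝒜 (y - algebraMap ℂ _ (GSym.counit 𝒜 y)) =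
      GSym.cumulantHom 𝒜 y - algebraMap ℂ _ (GSym.counit 𝒜 (GSym.cumulantHom 𝒜 y))
    rw [map_sub, GSym.counit_cumulantHom, Algebra.algebraMap_eq_smul_one, map_smul,
      GSym.cumulantHom_one]
  simp only [SymCoalg.comul, LinearMap.comp_apply]
  have h2 : Submodule.subtype _ ((SymCoalg.cumulantMap 𝒜).toLinearMap x) =
      GSym.cumulantHom 𝒜 x.1 := rfl
  rw [h2, GSym.comul_cumulantHom, TensorProduct.map_map, TensorProduct.map_map, h1]
  rfl

theorem SymCoalg.proj_cumulantMap {A : Type*} [Ring A] [Algebra ℂ A]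
    (𝒜 : ℤ → Submodule ℂ A) [GradedAlgebra 𝒜] [GradedCommutative 𝒜] (x : SymCoalg 𝒜) :
    SymCoalg.proj 𝒜 (SymCoalg.cumulantMap 𝒜 x) = SymCoalg.mulMap 𝒜 x := by
  have hx : GSym.counit 𝒜 x.1 = 0 := x.2
  have := GSym.proj_cumulantHom 𝒜 x.1
  rw [hx, zero_smul, sub_zero] at this
  exact this

section Forms

open Polynomial

/-- The graded commutative algebra `ℂ[t, dt]`: the element `(p, q)` is `p(t) + q(t) dt`, and
`dt * dt = 0`. -/
abbrev Forms : Type := TrivSqZeroExt ℂ[X] ℂ[X]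

namespace Forms

/-- The projection `p + q dt ↦ p`. -/
def even : Forms →ₗ[ℂ] Forms where
  toFun ω := TrivSqZeroExt.inl ω.fst
  map_add' := by intros; ext <;> simp
  map_smul' := by intros; ext <;> simp

/-- The projection `p + q dt ↦ q dt`. -/
def odd : Forms →ₗ[ℂ] Forms where
  toFun ω := TrivSqZeroExt.inr ω.snd
  map_add' := by intros; ext <;> simp
  map_smul' := by intros; ext <;> simp

/-- The differential `p + q dt ↦ p' dt`. -/
def d : Forms →ₗ[ℂ] Forms where
  toFun ω := TrivSqZeroExt.inr (derivative ω.fst)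
  map_add' := by intros; ext <;> simp
  map_smul' := by intros; ext <;> simp

/-- Evaluation at `t = c`: `p + q dt ↦ p(c)`. -/
def eval (c : ℂ) : Forms →ₗ[ℂ] ℂ where
  toFun ω := ω.fst.eval c
  map_add' := by intros; simp
  map_smul' := by intros; simp

/-- The grading of `ℂ[t, dt]`, with `t` of degree `0` and `dt` of degree `1`. -/
def degree (k : ℤ) : Submodule ℂ Forms :=
  if k = 0 then LinearMap.range even else if k = 1 then LinearMap.range odd else ⊥

end Forms

end Forms

section Homotopy

variable {W : Type*} [AddCommGroup W] [Module ℂ W]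
variable (𝒱 : ℤ → Submodule ℂ V) [DirectSum.Decomposition 𝒱]
variable (𝒲 : ℤ → Submodule ℂ W) [DirectSum.Decomposition 𝒲]

namespace SymForms

/-- The total degree `k` part of `SW ⊗ ℂ[t, dt]`. -/
def degree (k : ℤ) : Submodule ℂ (SymCoalg 𝒲 ⊗[ℂ] Forms) :=
  ⨆ j : ℤ, Submodule.map₂ (TensorProduct.mk ℂ (SymCoalg 𝒲) Forms)
    (SymCoalg.degree 𝒲 (k - j)) (Forms.degree j)

/-- The coproduct of `SW ⊗ ℂ[t, dt]`, a coalgebra over `ℂ[t, dt]`, with values in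
`(SW ⊗ ℂ[t, dt]) ⊗_{ℂ[t, dt]} (SW ⊗ ℂ[t, dt]) = (SW ⊗ SW) ⊗ ℂ[t, dt]`. -/
def comul : SymCoalg 𝒲 ⊗[ℂ] Forms →ₗ[ℂ] (SymCoalg 𝒲 ⊗[ℂ] SymCoalg 𝒲) ⊗[ℂ] Forms :=
  TensorProduct.map (SymCoalg.comul 𝒲) LinearMap.id

/-- The canonical map from `(SW ⊗ ℂ[t, dt]) ⊗ (SW ⊗ ℂ[t, dt])` to the tensor product over
`ℂ[t, dt]`: `(a ⊗ ω) ⊗ (b ⊗ η) ↦ (-1)^(|ω| |b|) (a ⊗ b) ⊗ ω η`. -/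
def toRelTensor : (SymCoalg 𝒲 ⊗[ℂ] Forms) ⊗[ℂ] (SymCoalg 𝒲 ⊗[ℂ] Forms) →ₗ[ℂ]
    (SymCoalg 𝒲 ⊗[ℂ] SymCoalg 𝒲) ⊗[ℂ] Forms :=
  TensorProduct.map LinearMap.id (LinearMap.mul' ℂ Forms) ∘ₗ
    (TensorProduct.tensorTensorTensorComm ℂ (SymCoalg 𝒲) Forms (SymCoalg 𝒲) Forms).toLinearMap ∘ₗ
    (TensorProduct.map (TensorProduct.map LinearMap.id Forms.even) LinearMap.id +
      TensorProduct.map (TensorProduct.map LinearMap.id Forms.odd)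
        (TensorProduct.map (SymCoalg.parity 𝒲) LinearMap.id))

/-- The differential `D ⊗ 1 + 1 ⊗ d` of `SW ⊗ ℂ[t, dt]`:
`a ⊗ ω ↦ D a ⊗ ω + (-1)^|a| a ⊗ dω`. -/
def differential (D : SymCoalg 𝒲 →ₗ[ℂ] SymCoalg 𝒲) :
    SymCoalg 𝒲 ⊗[ℂ] Forms →ₗ[ℂ] SymCoalg 𝒲 ⊗[ℂ] Forms :=
  TensorProduct.map D LinearMap.id + TensorProduct.map (SymCoalg.parity 𝒲) Forms.d

/-- The evaluation `SW ⊗ ℂ[t, dt] → SW` at `t = c`. -/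
def eval (c : ℂ) : SymCoalg 𝒲 ⊗[ℂ] Forms →ₗ[ℂ] SymCoalg 𝒲 :=
  (TensorProduct.rid ℂ (SymCoalg 𝒲)).toLinearMap ∘ₗ TensorProduct.map LinearMap.id (Forms.eval c)

end SymForms

/-- An `L∞` morphism `H : SV → SW ⊗ ℂ[t, dt]` from `(V, D)` to the extension of scalars of
`(W, D')` by `ℂ[t, dt]`: a degree zero map of coalgebras that commutes with the differentials.
Here `SW ⊗ ℂ[t, dt]` is the symmetric coalgebra over `ℂ[t, dt]` of `W ⊗ ℂ[t, dt]`. -/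
structure IsLInfinityHomotopy (D : SymCoalg 𝒱 →ₗ[ℂ] SymCoalg 𝒱) (D' : SymCoalg 𝒲 →ₗ[ℂ] SymCoalg 𝒲)
    (H : SymCoalg 𝒱 →ₗ[ℂ] SymCoalg 𝒲 ⊗[ℂ] Forms) : Prop where
  coalg : SymForms.comul 𝒲 ∘ₗ H =
    SymForms.toRelTensor 𝒲 ∘ₗ TensorProduct.map H H ∘ₗ SymCoalg.comul 𝒱
  degree_zero : ∀ k, ∀ x ∈ SymCoalg.degree 𝒱 k, H x ∈ SymForms.degree 𝒲 k
  comm : SymForms.differential 𝒲 D' ∘ₗ H = H ∘ₗ D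

/-- `L∞` morphisms `F, G : (V, D) → (W, D')` are homotopic if there is an `L∞` morphism
`H : SV → SW ⊗ ℂ[t, dt]` with `H(0) = F` and `H(1) = G`. -/
def LInfinityHomotopic (D : SymCoalg 𝒱 →ₗ[ℂ] SymCoalg 𝒱) (D' : SymCoalg 𝒲 →ₗ[ℂ] SymCoalg 𝒲)
    (F G : SymCoalg 𝒱 →ₗ[ℂ] SymCoalg 𝒲) : Prop :=
  ∃ H : SymCoalg 𝒱 →ₗ[ℂ] SymCoalg 𝒲 ⊗[ℂ] Forms, IsLInfinityHomotopy 𝒱 𝒲 D D' H ∧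
    SymForms.eval 𝒲 0 ∘ₗ H = F ∧ SymForms.eval 𝒲 1 ∘ₗ H = G

end Homotopy

section DegreeZero

/-- The grading that puts all of `M` in degree zero. -/
def trivialGrading (M : Type*) [AddCommGroup M] [Module ℂ M] (k : ℤ) : Submodule ℂ M :=
  if k = 0 then ⊤ else ⊥

theorem mem_trivialGrading_zero {M : Type*} [AddCommGroup M] [Module ℂ M] (m : M) :
    m ∈ trivialGrading M 0 := by simp [trivialGrading]

theorem eq_zero_of_mem_trivialGrading {M : Type*} [AddCommGroup M] [Module ℂ M] {k : ℤ}
    (hk : k ≠ 0) {m : M} (hm : m ∈ trivialGrading M k) : m = 0 := by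
  simpa [trivialGrading, hk] using hm

instance (M : Type*) [AddCommGroup M] [Module ℂ M] :
    DirectSum.Decomposition (trivialGrading M) :=
  DirectSum.Decomposition.ofLinearMap _
    (DirectSum.lof ℂ ℤ (fun k => trivialGrading M k) 0 ∘ₗ
      LinearMap.id.codRestrict (trivialGrading M 0) mem_trivialGrading_zero)
    (by ext m; simp)
    (by
      ext k m : 2
      by_cases hk : k = 0
      · subst hk
        simp only [LinearMap.comp_apply, DirectSum.coeLinearMap_lof, LinearMap.id_apply]
        rfl
      · have : m = 0 := Subtype.ext (eq_zero_of_mem_trivialGrading hk m.2)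
        simp [this])

instance (A : Type*) [Ring A] [Algebra ℂ A] : GradedAlgebra (trivialGrading A) where
  one_mem := mem_trivialGrading_zero 1
  mul_mem := by
    intro i j a b ha hb
    by_cases hi : i = 0
    · by_cases hj : j = 0
      · subst hi hj; exact mem_trivialGrading_zero _
      · rw [eq_zero_of_mem_trivialGrading hj hb, mul_zero]; exact zero_mem _
    · rw [eq_zero_of_mem_trivialGrading hi ha, zero_mul]; exact zero_mem _

instance (A : Type*) [CommRing A] [Algebra ℂ A] : GradedCommutative (trivialGrading A) where
  mul_comm' := by
    intro i j a ha b hb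
    by_cases hi : i = 0
    · subst hi; simp [mul_comm]
    · rw [eq_zero_of_mem_trivialGrading hi ha]; simp

end DegreeZero

section Cohomology

variable {W : Type*} [AddCommGroup W] [Module ℂ W]

/-- The (total) cohomology `ker d / im d` of a complex. -/
abbrev Cohomology (d : V →ₗ[ℂ] V) : Type _ :=
  LinearMap.ker d ⧸ (LinearMap.range d).submoduleOf (LinearMap.ker d)

/-- The map induced on cohomology by a chain map. -/
def Cohomology.map {d : V →ₗ[ℂ] V} {d' : W →ₗ[ℂ] W} (f : V →ₗ[ℂ] W) (hf : f ∘ₗ d = d' ∘ₗ f) :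
    Cohomology d →ₗ[ℂ] Cohomology d' :=
  Submodule.mapQ _ _
    (f.restrict (p := LinearMap.ker d) (q := LinearMap.ker d') (fun x hx => by
      have := LinearMap.congr_fun hf x
      simp only [LinearMap.comp_apply, LinearMap.mem_ker.1 hx, map_zero] at this
      exact this.symm))
    (by
      rintro ⟨_, hx⟩ ⟨y, rfl⟩
      exact ⟨f y, (LinearMap.congr_fun hf y).symm⟩)

/-- A chain map is a quasi-isomorphism if it induces an isomorphism on cohomology. -/
def IsQuasiIso {d : V →ₗ[ℂ] V} {d' : W →ₗ[ℂ] W} (f : V →ₗ[ℂ] W) (hf : f ∘ₗ d = d' ∘ₗ f) : Prop :=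
  Function.Bijective (Cohomology.map f hf)

end Cohomology

/-- A unital commutative homotopy probability space: a cochain complex `(V, d)` of complex vector
spaces with a graded commutative, associative, unital product, such that the unit `ℂ → V` and the
expectation `E : V → ℂ` are maps of complexes and `E 1 = 1`. The differential need not be
compatible with the product, nor the expectation. -/
structure ProbabilitySpace {A : Type*} [Ring A] [Algebra ℂ A] (𝒜 : ℤ → Submodule ℂ A)
    [GradedAlgebra 𝒜] [GradedCommutative 𝒜] where
  d : A →ₗ[ℂ] A
  d_mem : ∀ i, ∀ a ∈ 𝒜 i, d a ∈ 𝒜 (i + 1)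
  d_comp_d : d ∘ₗ d = 0
  d_one : d 1 = 0
  expectation : A →ₗ[ℂ] ℂ
  expectation_mem : ∀ i, ∀ a ∈ 𝒜 i, expectation a ∈ trivialGrading ℂ i
  expectation_comp_d : expectation ∘ₗ d = 0
  expectation_one : expectation 1 = 1

namespace ProbabilitySpace

variable {A : Type*} [Ring A] [Algebra ℂ A] {𝒜 : ℤ → Submodule ℂ A} [GradedAlgebra 𝒜]
  [GradedCommutative 𝒜] (P : ProbabilitySpace 𝒜)

/-- A probability space is contractible if the expectation `(V, d) → (ℂ, 0)` is a
quasi-isomorphism. -/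
def IsContractible : Prop :=
  IsQuasiIso (d := P.d) (d' := 0) P.expectation
    (by rw [P.expectation_comp_d, LinearMap.zero_comp])

/-- The transported structure `d^φ`: the `L∞` structure given by the differential, transported by
the cumulant map. -/
def transportedStructure : SymCoalg 𝒜 →ₗ[ℂ] SymCoalg 𝒜 :=
  SymCoalg.transport 𝒜 𝒜 (SymCoalg.extend 𝒜 P.d)

/-- The total cumulant `K = E^φ : SV → Sℂ`. -/
def totalCumulant : SymCoalg 𝒜 →ₗ[ℂ] SymCoalg (trivialGrading ℂ) :=
  SymCoalg.transport 𝒜 (trivialGrading ℂ)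
    (SymCoalg.map 𝒜 (trivialGrading ℂ) P.expectation P.expectation_mem)

/-- A collection of `n` homotopy random variables: an `L∞` morphism from `(ℂⁿ, 0)`, with `ℂⁿ` in
degree zero, to `(V, d^φ)`. -/
structure Collection (n : ℕ) where
  toLinearMap : SymCoalg (trivialGrading (Fin n → ℂ)) →ₗ[ℂ] SymCoalg 𝒜
  isLInfinityMorphism : IsLInfinityMorphism (trivialGrading (Fin n → ℂ)) 𝒜 0
    P.transportedStructure toLinearMap

variable {P}

/-- The joint cumulant `K X : Sℂⁿ → Sℂ` of a collection of homotopy random variables. -/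
def Collection.jointCumulant {n : ℕ} (X : P.Collection n) :
    SymCoalg (trivialGrading (Fin n → ℂ)) →ₗ[ℂ] SymCoalg (trivialGrading ℂ) :=
  P.totalCumulant ∘ₗ X.toLinearMap

/-- Two collections of homotopy random variables are homotopic if they are homotopic as `L∞`
morphisms from `(ℂⁿ, 0)` to `(V, d^φ)`. -/
def Collection.Homotopic {n : ℕ} (X Y : P.Collection n) : Prop :=
  LInfinityHomotopic (trivialGrading (Fin n → ℂ)) 𝒜 0 P.transportedStructure
    X.toLinearMap Y.toLinearMap

end ProbabilitySpace

end HPT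

end

noncomputable section

namespace HPT

open scoped DirectSum TensorProduct Polynomial

open TrivSqZeroExt (inl inr)

namespace GSym

section Graded

variable {V : Type*} [AddCommGroup V] [Module ℂ V]
variable (𝒱 : ℤ → Submodule ℂ V) [DirectSum.Decomposition 𝒱]

theorem counit_of_mem_degree {k : ℤ} (hk : k ≠ 0) {x : GSym 𝒱} (hx : x ∈ degree 𝒱 k) :
    counit 𝒱 x = 0 := by
  induction hx using Submodule.span_induction with
  | mem x hx =>
    obtain ⟨l, -, hl, rfl⟩ := hx
    cases l with
    | nil => exact absurd hl.symm hk
    | cons q l => simp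
  | zero => simp
  | add a b _ _ ha hb => simp [ha, hb]
  | smul c a _ ha => simp [ha]

theorem proj_mem {k : ℤ} {x : GSym 𝒱} (hx : x ∈ degree 𝒱 k) :
    proj 𝒱 x ∈ 𝒱 k := by
  induction hx using Submodule.span_induction with
  | mem x hx =>
    obtain ⟨l, h, hl, rfl⟩ := hx
    match l with
    | [] => simp
    | [q] => simpa [← hl] using h
    | q :: r :: l => simp
  | zero => simp
  | add a b _ _ ha hb => rw [map_add]; exact add_mem ha hb
  | smul c a _ ha => rw [map_smul]; exact Submodule.smul_mem _ _ ha

theorem ι_mul_mem_degree {i k : ℤ} {v : V} (hv : v ∈ 𝒱 i) {x : GSym 𝒱} (hx : x ∈ degree 𝒱 k) :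
    ι 𝒱 v * x ∈ degree 𝒱 (i + k) :=
  SetLike.GradedMul.mul_mem (ι_mem_degree 𝒱 hv) hx

theorem degree_induction {p : ℤ → GSym 𝒱 → Prop} (one : p 0 1)
    (cons : ∀ i k, ∀ v ∈ 𝒱 i, ∀ x ∈ degree 𝒱 k, p k x → p (i + k) (ι 𝒱 v * x))
    (zero : ∀ k, p k 0) (add : ∀ k x y, p k x → p k y → p k (x + y))
    (smul : ∀ k (c : ℂ) x, p k x → p k (c • x)) {k : ℤ} {x : GSym 𝒱} (hx : x ∈ degree 𝒱 k) :
    p k x := by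
  induction hx using Submodule.span_induction with
  | mem x hx =>
    obtain ⟨l, h, rfl, rfl⟩ := hx
    induction l with
    | nil => simpa using one
    | cons q l ih =>
      have h' : ∀ r ∈ l, r.2 ∈ 𝒱 r.1 := fun r hr => h r (by simp [hr])
      simpa using cons q.1 _ q.2 (h q (by simp)) _ (Submodule.subset_span ⟨l, h', rfl, rfl⟩) (ih h')
  | zero => exact zero k
  | add a b _ _ ha hb => exact add k a b ha hb
  | smul c a _ ha => exact smul k c a ha

theorem coderiv_mem_degree {g : V →ₗ[ℂ] V} {p : ℤ} (hg : ∀ i, ∀ v ∈ 𝒱 i, g v ∈ 𝒱 (i + p)) {k : ℤ}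
    {x : GSym 𝒱} (hx : x ∈ degree 𝒱 k) : coderiv 𝒱 g x ∈ degree 𝒱 (k + p) := by
  refine degree_induction 𝒱 (p := fun k x => coderiv 𝒱 g x ∈ degree 𝒱 (k + p)) ?_ ?_ ?_ ?_ ?_ hx
  · simp [coderiv_one]
  · intro i k v hv x hx ih
    rw [coderiv_ι_mul 𝒱 hg hv]
    refine add_mem ?_ (Submodule.smul_mem _ _ ?_)
    · rw [add_right_comm]
      exact ι_mul_mem_degree 𝒱 (hg i v hv) hx
    · rw [add_assoc]
      exact ι_mul_mem_degree 𝒱 hv ih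
  · simp
  · intro k x y hx hy; rw [map_add]; exact add_mem hx hy
  · intro k c x hx; rw [map_smul]; exact Submodule.smul_mem _ _ hx

theorem rcounit_comul (x : GSym 𝒱) :
    TensorProduct.rid ℂ _ (TensorProduct.map LinearMap.id (counit 𝒱).toLinearMap (comul 𝒱 x)) = x := by
  suffices (TensorProduct.rid ℂ _).toLinearMap ∘ₗ
      (TensorProduct.map LinearMap.id (counit 𝒱).toLinearMap) ∘ₗ comul 𝒱 = LinearMap.id from
    LinearMap.congr_fun this x
  apply lhom_ext_cons 𝒱
  · simp [comul_one]
  · intro i v hv x hx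
    have key : (TensorProduct.rid ℂ _).toLinearMap ∘ₗ
      (TensorProduct.map LinearMap.id (counit 𝒱).toLinearMap) ∘ₗ consTensor 𝒱 i v =
      LinearMap.mulLeft ℂ (ι 𝒱 v) ∘ₗ (TensorProduct.rid ℂ _).toLinearMap ∘ₗ
      (TensorProduct.map LinearMap.id (counit 𝒱).toLinearMap) := by
      ext a b
      simp [consTensor]
    have := LinearMap.congr_fun key (comul 𝒱 x)
    simp only [LinearMap.comp_apply, LinearMap.id_apply] at this hx ⊢
    rw [comul_ι_mul 𝒱 hv, this, hx]
    simp

theorem coderiv_id_ι_mul (v : V) (x : GSym 𝒱) : coderiv 𝒱 LinearMap.id (ι 𝒱 v * x) =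
    ι 𝒱 v * x + ι 𝒱 v * coderiv 𝒱 LinearMap.id x := by
  induction v using DirectSum.Decomposition.inductionOn 𝒱 with
  | zero => simp
  | homogeneous m =>
    simpa using coderiv_ι_mul 𝒱 (g := LinearMap.id) (p := 0) (by simp) m.2 x
  | add a b ha hb => simp only [map_add, add_mul, ha, hb]; abel

section Map

variable {W : Type*} [AddCommGroup W] [Module ℂ W] (𝒲 : ℤ → Submodule ℂ W)
  [DirectSum.Decomposition 𝒲] (f : V →ₗ[ℂ] W) (hf : ∀ i, ∀ v ∈ 𝒱 i, f v ∈ 𝒲 i)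

@[simp] theorem map_ι (v : V) : map 𝒱 𝒲 f hf (ι 𝒱 v) = ι 𝒲 (f v) := by simp [map]

theorem signTwist_map (q : ℤ) (x : GSym 𝒱) : signTwist (degree 𝒲) q (map 𝒱 𝒲 f hf x) =
    map 𝒱 𝒲 f hf (signTwist (degree 𝒱) q x) := by
  suffices signTwist (degree 𝒲) q ∘ₗ (map 𝒱 𝒲 f hf).toLinearMap =
      (map 𝒱 𝒲 f hf).toLinearMap ∘ₗ signTwist (degree 𝒱) q from LinearMap.congr_fun this x
  apply lhom_ext_cons 𝒱
  · simp
  · intro i v hv x hx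
    simp only [LinearMap.comp_apply, AlgHom.toLinearMap_apply] at hx ⊢
    rw [map_mul, map_ι, signTwist_ι_mul 𝒲 q (hf i v hv), hx, signTwist_ι_mul 𝒱 q hv, map_smul,
      map_mul, map_ι]

theorem comul_map : comul 𝒲 ∘ₗ (map 𝒱 𝒲 f hf).toLinearMap =
    TensorProduct.map (map 𝒱 𝒲 f hf).toLinearMap (map 𝒱 𝒲 f hf).toLinearMap ∘ₗ comul 𝒱 := by
  apply lhom_ext_cons 𝒱
  · simp [comul_one]
  · intro i v hv x hx
    simp only [LinearMap.comp_apply, AlgHom.toLinearMap_apply] at hx ⊢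
    rw [map_mul, map_ι, comul_ι_mul 𝒲 (hf i v hv), hx, comul_ι_mul 𝒱 hv]
    have key : TensorProduct.map (map 𝒱 𝒲 f hf).toLinearMap (map 𝒱 𝒲 f hf).toLinearMap ∘ₗ
        consTensor 𝒱 i v = consTensor 𝒲 i (f v) ∘ₗ
        TensorProduct.map (map 𝒱 𝒲 f hf).toLinearMap (map 𝒱 𝒲 f hf).toLinearMap := by
      ext a b
      simp [consTensor, signTwist_map]
    exact (LinearMap.congr_fun key (comul 𝒱 x)).symm

theorem proj_map (x : GSym 𝒱) : proj 𝒲 (map 𝒱 𝒲 f hf x) = f (proj 𝒱 x) := by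
  suffices proj 𝒲 ∘ₗ (map 𝒱 𝒲 f hf).toLinearMap = f ∘ₗ proj 𝒱 from LinearMap.congr_fun this x
  apply lhom_ext_cons 𝒱
  · simp
  · intro i v hv x hx
    simp [counit_map]

theorem map_coderiv_eq_zero {g : V →ₗ[ℂ] V} {p : ℤ} (hg : ∀ i, ∀ v ∈ 𝒱 i, g v ∈ 𝒱 (i + p))
    (hfg : f ∘ₗ g = 0) (x : GSym 𝒱) : map 𝒱 𝒲 f hf (coderiv 𝒱 g x) = 0 := by
  suffices (map 𝒱 𝒲 f hf).toLinearMap ∘ₗ coderiv 𝒱 g = 0 from LinearMap.congr_fun this x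
  apply lhom_ext_cons 𝒱
  · simp [coderiv_one]
  · intro i v hv x hx
    have h := LinearMap.congr_fun hfg v
    simp only [LinearMap.comp_apply, AlgHom.toLinearMap_apply, LinearMap.zero_apply] at hx h ⊢
    simp [coderiv_ι_mul 𝒱 hg hv, hx, h]

end Map

theorem proj_coderiv {g : V →ₗ[ℂ] V} {p : ℤ} (hg : ∀ i, ∀ v ∈ 𝒱 i, g v ∈ 𝒱 (i + p))
    (x : GSym 𝒱) : proj 𝒱 (coderiv 𝒱 g x) = g (proj 𝒱 x) := by
  suffices proj 𝒱 ∘ₗ coderiv 𝒱 g = g ∘ₗ proj 𝒱 from LinearMap.congr_fun this x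
  apply lhom_ext_cons 𝒱
  · simp [coderiv_one]
  · intro i v hv x hx
    simp [coderiv_ι_mul 𝒱 hg hv, counit_coderiv]

end Graded

section Algebra

variable {A : Type*} [Ring A] [Algebra ℂ A] (𝒜 : ℤ → Submodule ℂ A) [GradedAlgebra 𝒜]
  [GradedCommutative 𝒜]

theorem cumulantHom_mem_degree {k : ℤ} {x : GSym 𝒜} (hx : x ∈ degree 𝒜 k) :
    cumulantHom 𝒜 x ∈ degree 𝒜 k := by
  refine degree_induction 𝒜 (p := fun k x => cumulantHom 𝒜 x ∈ degree 𝒜 k) ?_ ?_ ?_ ?_ ?_ hx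
  · rw [cumulantHom_one]; exact SetLike.GradedOne.one_mem
  · intro i k v hv x hx ih
    have hg : ∀ j, ∀ w ∈ 𝒜 j, LinearMap.mulLeft ℂ v w ∈ 𝒜 (j + i) := by
      intro j w hw
      rw [add_comm]
      exact SetLike.GradedMul.mul_mem hv hw
    rw [cumulantHom_ι_mul]
    refine add_mem (ι_mul_mem_degree 𝒜 hv ih) ?_
    rw [add_comm]
    exact coderiv_mem_degree 𝒜 hg ih
  · simp
  · intro k x y hx hy; rw [map_add]; exact add_mem hx hy
  · intro k c x hx; rw [map_smul]; exact Submodule.smul_mem _ _ hx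

theorem mem_degree_of_cumulantHom_mem {k : ℤ} {x : GSym 𝒜} (hx : cumulantHom 𝒜 x ∈ degree 𝒜 k) :
    x ∈ degree 𝒜 k := by
  have h : GradedRing.proj (degree 𝒜) k (cumulantHom 𝒜 x) =
      cumulantHom 𝒜 (GradedRing.proj (degree 𝒜) k x) := by
    clear hx
    induction x using DirectSum.Decomposition.inductionOn (degree 𝒜) with
    | zero => simp
    | @homogeneous i m =>
      simp only [GradedRing.proj_apply, DirectSum.decompose_coe, DirectSum.coe_of_apply,
        DirectSum.decompose_of_mem (degree 𝒜) (cumulantHom_mem_degree 𝒜 m.2)]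
      split_ifs <;> simp
    | add a b ha hb => simp only [map_add, ha, hb]
  rw [GradedRing.proj_apply, DirectSum.decompose_of_mem_same (degree 𝒜) hx] at h
  rw [(cumulantHom_bijective 𝒜).1 h]
  exact SetLike.coe_mem _

theorem coderiv_id_sub_mem_wordLT {n : ℕ} {x : GSym 𝒜} (hx : x ∈ wordLT 𝒜 (n + 1)) :
    coderiv 𝒜 LinearMap.id x - (n : ℂ) • x ∈ wordLT 𝒜 n := by
  induction hx using Submodule.span_induction with
  | mem x hx =>
    obtain ⟨l, hl, h, rfl⟩ := hx
    suffices coderiv 𝒜 LinearMap.id (l.map fun q => ι 𝒜 q.2).prod =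
        (l.length : ℂ) • (l.map fun q => ι 𝒜 q.2).prod by
      rw [this]
      rcases (Nat.lt_succ_iff.1 hl).lt_or_eq with h' | h'
      · exact sub_mem (Submodule.smul_mem _ _ (Submodule.subset_span ⟨l, h', h, rfl⟩))
          (Submodule.smul_mem _ _ (Submodule.subset_span ⟨l, h', h, rfl⟩))
      · simp [h']
    clear hl h
    induction l with
    | nil => simp [coderiv_one]
    | cons q l ih =>
      simp only [List.map_cons, List.prod_cons, coderiv_id_ι_mul, ih, List.length_cons]
      push_cast
      rw [mul_smul_comm]
      module
  | zero => simp
  | add a b _ _ ha hb => rw [map_add, smul_add, add_sub_add_comm]; exact add_mem ha hb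
  | smul c a _ ha =>
    rw [map_smul, smul_comm, ← smul_sub]; exact Submodule.smul_mem _ _ ha

/-- The Euler operator, which multiplies a word by its length, kills only the scalars. -/
theorem eq_zero_of_coderiv_id_eq_zero {x : GSym 𝒜} (h : coderiv 𝒜 LinearMap.id x = 0)
    (hx : counit 𝒜 x = 0) : x = 0 := by
  obtain ⟨n, hn⟩ := exists_mem_wordLT 𝒜 x
  induction n with
  | zero => simpa [wordLT_zero] using hn
  | succ n ih =>
    rcases Nat.eq_zero_or_pos n with rfl | hpos
    · obtain ⟨c, rfl⟩ : ∃ c : ℂ, c • (1 : GSym 𝒜) = x := by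
        rw [← Submodule.mem_span_singleton]
        refine Submodule.span_mono ?_ hn
        rintro _ ⟨l, hl, -, rfl⟩
        obtain rfl : l = [] := List.length_eq_zero_iff.1 (by omega)
        simp
      have : c = 0 := by simpa using hx
      simp [this]
    · have := coderiv_id_sub_mem_wordLT 𝒜 hn
      rw [h, zero_sub, neg_mem_iff, Submodule.smul_mem_iff _ (by exact_mod_cast hpos.ne')] at this
      exact ih this

end Algebra

end GSym

namespace SymCoalg

variable {V : Type*} [AddCommGroup V] [Module ℂ V] (𝒱 : ℤ → Submodule ℂ V)

theorem coe_reduce (x : GSym 𝒱) :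
    (reduce 𝒱 x : GSym 𝒱) = x - GSym.counit 𝒱 x • (1 : GSym 𝒱) := by
  rw [← Algebra.algebraMap_eq_smul_one]; rfl

@[simp] theorem reduce_one : reduce 𝒱 1 = 0 := Subtype.ext (by simp [coe_reduce])

@[simp] theorem reduce_coe (x : SymCoalg 𝒱) : reduce 𝒱 x = x := by
  have hx : GSym.counit 𝒱 x = 0 := x.2
  exact Subtype.ext (by rw [coe_reduce, hx, zero_smul, sub_zero])

theorem proj_apply (x : SymCoalg 𝒱) : proj 𝒱 x = GSym.proj 𝒱 x := rfl

variable [DirectSum.Decomposition 𝒱]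

@[simp] theorem proj_reduce (x : GSym 𝒱) : proj 𝒱 (reduce 𝒱 x) = GSym.proj 𝒱 x := by
  simp [proj_apply, coe_reduce]

theorem comul_comp_reduce : comul 𝒱 ∘ₗ reduce 𝒱 =
    TensorProduct.map (reduce 𝒱) (reduce 𝒱) ∘ₗ GSym.comul 𝒱 := by
  ext x
  simp only [comul, LinearMap.comp_apply, Submodule.subtype_apply, coe_reduce, map_sub, map_smul,
    GSym.comul_one, TensorProduct.map_tmul, reduce_one, TensorProduct.tmul_zero, smul_zero]
  exact sub_zero (TensorProduct.map (reduce 𝒱) (reduce 𝒱) (GSym.comul 𝒱 x))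

theorem parity_reduce (x : GSym 𝒱) : parity 𝒱 (reduce 𝒱 x) =
    reduce 𝒱 (signTwist (GSym.degree 𝒱) 1 x) := by
  apply Subtype.ext
  change signTwist (GSym.degree 𝒱) 1 (reduce 𝒱 x : GSym 𝒱) = _
  rw [coe_reduce, coe_reduce, map_sub, map_smul, GSym.signTwist_one,
    GSym.counit_signTwist]

theorem extend_reduce (d : V →ₗ[ℂ] V) (x : GSym 𝒱) :
    extend 𝒱 d (reduce 𝒱 x) = reduce 𝒱 (GSym.coderiv 𝒱 d x) := by
  apply Subtype.ext
  change GSym.coderiv 𝒱 d (reduce 𝒱 x : GSym 𝒱) = _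
  rw [coe_reduce, coe_reduce, map_sub, map_smul, GSym.coderiv_one,
    GSym.counit_coderiv, smul_zero, zero_smul]

/-- The Euler operator in terms of the reduced coproduct. -/
theorem coderiv_id_coe (x : SymCoalg 𝒱) : GSym.coderiv 𝒱 LinearMap.id x =
    GSym.ι 𝒱 (proj 𝒱 x) + LinearMap.mul' ℂ (GSym 𝒱)
      (TensorProduct.map (GSym.ι 𝒱 ∘ₗ proj 𝒱) (Submodule.subtype _) (comul 𝒱 x)) := by
  have key : LinearMap.mul' ℂ (GSym 𝒱) ∘ₗ
      TensorProduct.map (GSym.ι 𝒱 ∘ₗ LinearMap.id ∘ₗ GSym.proj 𝒱) LinearMap.id =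
      GSym.ι 𝒱 ∘ₗ GSym.proj 𝒱 ∘ₗ (TensorProduct.rid ℂ _).toLinearMap ∘ₗ
        TensorProduct.map LinearMap.id (GSym.counit 𝒱).toLinearMap +
      LinearMap.mul' ℂ (GSym 𝒱) ∘ₗ TensorProduct.map (GSym.ι 𝒱 ∘ₗ proj 𝒱) (Submodule.subtype _) ∘ₗ
        TensorProduct.map (reduce 𝒱) (reduce 𝒱) := by
    ext a b
    simp [coe_reduce, mul_sub]
  have h := LinearMap.congr_fun key (GSym.comul 𝒱 x)
  simp only [LinearMap.comp_apply, LinearMap.add_apply, LinearEquiv.coe_coe,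
    GSym.rcounit_comul] at h
  exact h

/-- A map of symmetric algebras that is unital and compatible with the coproducts restricts to a
map of symmetric coalgebras. -/
theorem isCoalgHom_of_comul {W : Type*} [AddCommGroup W] [Module ℂ W] (𝒲 : ℤ → Submodule ℂ W)
    [DirectSum.Decomposition 𝒲] {F : GSym 𝒱 →ₗ[ℂ] GSym 𝒲} (h1 : F 1 = 1)
    (hF : GSym.comul 𝒲 ∘ₗ F = TensorProduct.map F F ∘ₗ GSym.comul 𝒱) :
    IsCoalgHom 𝒱 𝒲 (reduce 𝒲 ∘ₗ F ∘ₗ Submodule.subtype _) := by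
  have h2 : (reduce 𝒲 ∘ₗ F ∘ₗ Submodule.subtype _) ∘ₗ reduce 𝒱 = reduce 𝒲 ∘ₗ F := by
    ext1 x
    simp [coe_reduce, h1]
  ext1 x
  have e1 := LinearMap.congr_fun (comul_comp_reduce 𝒲) (F x)
  have e2 := LinearMap.congr_fun hF x
  simp only [LinearMap.comp_apply] at e1 e2
  simp only [LinearMap.comp_apply, Submodule.subtype_apply, comul, TensorProduct.map_map]
  rw [h2, ← TensorProduct.map_map, ← e2]
  exact e1

end SymCoalg

section Uniqueness

variable {B : Type*} [Ring B] [Algebra ℂ B] (ℬ : ℤ → Submodule ℂ B) [GradedAlgebra ℬ]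
  [GradedCommutative ℬ]

theorem SymCoalg.reduce_mem_wordLT {n : ℕ} {x : GSym ℬ} (hx : x ∈ GSym.wordLT ℬ n) :
    (reduce ℬ x : GSym ℬ) ∈ GSym.wordLT ℬ n := by
  cases n with
  | zero => simp_all [GSym.wordLT_zero]
  | succ n =>
    rw [coe_reduce]
    exact sub_mem hx (Submodule.smul_mem _ _ (Submodule.subset_span ⟨[], by simp, by simp, by simp⟩))

theorem GSym.comul_mem_of_mem_wordLT {n : ℕ} {x : GSym ℬ} (hx : x ∈ wordLT ℬ (n + 1)) :
    comul ℬ x ∈ Submodule.map₂ (TensorProduct.mk ℂ _ _) (Submodule.span ℂ {1}) ⊤ ⊔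
      Submodule.map₂ (TensorProduct.mk ℂ _ _) ⊤ (wordLT ℬ n) := by
  have hx' : comul ℬ x ∈
      Submodule.map₂ (TensorProduct.mk ℂ _ _) (Submodule.span ℂ {1}) (wordLT ℬ (n + 1)) ⊔
      Submodule.map₂ (TensorProduct.mk ℂ _ _) ⊤ (wordLT ℬ n) := by
    induction hx using Submodule.span_induction with
    | mem x hx =>
      obtain ⟨l, hl, h, rfl⟩ := hx
      induction l generalizing n with
      | nil =>
        refine Submodule.mem_sup_left ?_
        simp only [List.map_nil, List.prod_nil, comul_one]
        exact Submodule.apply_mem_map₂ _ (Submodule.mem_span_singleton_self _)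
          (Submodule.subset_span ⟨[], by simp, by simp, by simp⟩)
      | cons q l ih =>
        obtain ⟨n, rfl⟩ : ∃ m, n = m + 1 := ⟨n - 1, by simp at hl; omega⟩
        have hq : q.2 ∈ ℬ q.1 := h q (by simp)
        have hl' : l.length < n + 1 := by simpa using hl
        have h' : ∀ r ∈ l, r.2 ∈ ℬ r.1 := fun r hr => h r (by simp [hr])
        have := ih hl' h'
        simp only [List.map_cons, List.prod_cons, comul_ι_mul ℬ hq]
        refine Submodule.mem_comap.1 ((?_ : _ ≤ Submodule.comap (consTensor ℬ q.1 q.2) _) this)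
        rw [sup_le_iff, Submodule.map₂_le, Submodule.map₂_le]
        constructor
        · intro a ha b hb
          have hs : signTwist (degree ℬ) q.1 a = a := by
            obtain ⟨c, rfl⟩ := Submodule.mem_span_singleton.1 ha
            rw [map_smul, signTwist_one]
          rw [Submodule.mem_comap, TensorProduct.mk_apply, consTensor, LinearMap.add_apply,
            TensorProduct.map_tmul, TensorProduct.map_tmul, hs]
          exact add_mem
            (Submodule.mem_sup_right (Submodule.apply_mem_map₂ _ Submodule.mem_top hb))
            (Submodule.mem_sup_left (Submodule.apply_mem_map₂ _ ha (ι_mul_wordLT ℬ hq hb)))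
        · intro a _ b hb
          exact Submodule.mem_sup_right (add_mem
            (Submodule.apply_mem_map₂ _ Submodule.mem_top (wordLT_mono ℬ (Nat.le_succ n) hb))
            (Submodule.apply_mem_map₂ _ Submodule.mem_top (ι_mul_wordLT ℬ hq hb)))
    | zero => simp
    | add a b _ _ ha hb => rw [map_add]; exact add_mem ha hb
    | smul c a _ ha => rw [map_smul]; exact Submodule.smul_mem _ _ ha
  exact SetLike.le_def.1 (sup_le_sup_right (Submodule.map₂_le_map₂_right le_top) _) hx'

variable {A : Type*} [Ring A] [Algebra ℂ A] (𝒜 : ℤ → Submodule ℂ A) [GradedAlgebra 𝒜]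
  [GradedCommutative 𝒜]

/-- A map of symmetric coalgebras is determined by its composition with `proj`. -/
theorem IsCoalgHom.ext {F G : SymCoalg ℬ →ₗ[ℂ] SymCoalg 𝒜} (hF : IsCoalgHom ℬ 𝒜 F)
    (hG : IsCoalgHom ℬ 𝒜 G) (h : SymCoalg.proj 𝒜 ∘ₗ F = SymCoalg.proj 𝒜 ∘ₗ G) : F = G := by
  suffices ∀ n, ∀ x : SymCoalg ℬ, (x : GSym ℬ) ∈ GSym.wordLT ℬ n → F x = G x by
    ext1 x
    obtain ⟨n, hn⟩ := GSym.exists_mem_wordLT ℬ (x : GSym ℬ)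
    exact this n x hn
  intro n
  induction n with
  | zero =>
    intro x hx
    rw [GSym.wordLT_zero, Submodule.mem_bot, Submodule.coe_eq_zero] at hx
    simp [hx]
  | succ n ih =>
    intro x hx
    have euler : ∀ {F : SymCoalg ℬ →ₗ[ℂ] SymCoalg 𝒜}, IsCoalgHom ℬ 𝒜 F →
        GSym.coderiv 𝒜 LinearMap.id (F x) = GSym.ι 𝒜 (SymCoalg.proj 𝒜 (F x)) +
        LinearMap.mul' ℂ (GSym 𝒜) (TensorProduct.map (GSym.ι 𝒜 ∘ₗ SymCoalg.proj 𝒜 ∘ₗ F)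
          (Submodule.subtype _ ∘ₗ F) (SymCoalg.comul ℬ x)) := by
      intro F hF
      rw [SymCoalg.coderiv_id_coe]
      have := LinearMap.congr_fun hF x
      simp only [LinearMap.comp_apply] at this
      rw [this, TensorProduct.map_map]
      rfl
    have hp : SymCoalg.proj 𝒜 (F x) = SymCoalg.proj 𝒜 (G x) := LinearMap.congr_fun h x
    have hT : LinearMap.mul' ℂ (GSym 𝒜) (TensorProduct.map (GSym.ι 𝒜 ∘ₗ SymCoalg.proj 𝒜 ∘ₗ F)
          (Submodule.subtype _ ∘ₗ (F - G)) (SymCoalg.comul ℬ x)) = 0 := by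
      set T := LinearMap.mul' ℂ (GSym 𝒜) ∘ₗ TensorProduct.map (GSym.ι 𝒜 ∘ₗ SymCoalg.proj 𝒜 ∘ₗ F)
          (Submodule.subtype _ ∘ₗ (F - G)) ∘ₗ
          TensorProduct.map (SymCoalg.reduce ℬ) (SymCoalg.reduce ℬ) with hT
      refine LinearMap.mem_ker.1 ((?_ : _ ≤ LinearMap.ker T) (GSym.comul_mem_of_mem_wordLT ℬ hx))
      rw [sup_le_iff, Submodule.map₂_le, Submodule.map₂_le]
      constructor
      · intro a ha b _
        obtain ⟨c, rfl⟩ := Submodule.mem_span_singleton.1 ha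
        simp [T]
      · intro a _ b hb
        have := ih _ (SymCoalg.reduce_mem_wordLT ℬ hb)
        simp [T, this]
    have hsub : ∀ f : SymCoalg ℬ →ₗ[ℂ] GSym 𝒜, TensorProduct.map f (Submodule.subtype _ ∘ₗ (F - G)) =
        TensorProduct.map f (Submodule.subtype _ ∘ₗ F) -
          TensorProduct.map f (Submodule.subtype _ ∘ₗ G) := by
      intro f
      ext a b
      simp [TensorProduct.tmul_sub]
    refine Subtype.ext (sub_eq_zero.1 (GSym.eq_zero_of_coderiv_id_eq_zero 𝒜 ?_ ?_))
    · rw [map_sub, euler hF, euler hG, hp, add_sub_add_left_eq_sub, ← h, ← map_sub,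
        ← LinearMap.sub_apply, ← hsub]
      exact hT
    · exact (F x - G x).2

end Uniqueness

namespace GSym

variable (M : Type*) [AddCommGroup M] [Module ℂ M]

theorem mul_comm_of_trivialGrading (x y : GSym (trivialGrading M)) : x * y = y * x := by
  have hι : ∀ (v : M) (y : GSym (trivialGrading M)),
      ι (trivialGrading M) v * y = y * ι (trivialGrading M) v := by
    intro v y
    suffices LinearMap.mulLeft ℂ (ι (trivialGrading M) v) =
        LinearMap.mulRight ℂ (ι (trivialGrading M) v) from LinearMap.congr_fun this y
    apply lhom_ext_cons
    · simp
    · intro i w hw x hx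
      simp only [LinearMap.mulLeft_apply, LinearMap.mulRight_apply] at hx ⊢
      rw [mul_assoc, ← hx, ← mul_assoc, ← mul_assoc,
        ι_comm _ (mem_trivialGrading_zero v) (mem_trivialGrading_zero w)]
      simp
  suffices LinearMap.mulRight ℂ y = LinearMap.mulLeft ℂ y from LinearMap.congr_fun this x
  apply lhom_ext_cons
  · simp
  · intro i w hw x hx
    simp only [LinearMap.mulLeft_apply, LinearMap.mulRight_apply] at hx ⊢
    rw [mul_assoc, hx, ← mul_assoc, hι, mul_assoc]

instance : GradedCommutative (trivialGrading (GSym (trivialGrading M))) where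
  mul_comm' := by
    intro i j a ha b hb
    by_cases hi : i = 0
    · subst hi; simp [mul_comm_of_trivialGrading M a b]
    · rw [eq_zero_of_mem_trivialGrading hi ha]; simp

theorem map_mem_trivialGrading {M N : Type*} [AddCommGroup M] [Module ℂ M] [AddCommGroup N]
    [Module ℂ N] (f : M →ₗ[ℂ] N) (i : ℤ) (v : M) (hv : v ∈ trivialGrading M i) :
    f v ∈ trivialGrading N i := by
  by_cases hi : i = 0
  · subst hi; exact mem_trivialGrading_zero _
  · rw [eq_zero_of_mem_trivialGrading hi hv, map_zero]; exact zero_mem _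

/-- For `M` in degree zero, the map of coalgebras `S M → S (S M)` whose component `S M → S M` is the
projection away from the scalars. -/
def duplicate : GSym (trivialGrading M) →ₗ[ℂ]
    GSym (trivialGrading (GSym (trivialGrading M))) :=
  cumulantHom _ ∘ₗ (map (trivialGrading M) (trivialGrading (GSym (trivialGrading M)))
    (ι (trivialGrading M)) (map_mem_trivialGrading _)).toLinearMap

@[simp] theorem duplicate_one : duplicate M 1 = 1 := by simp [duplicate]

theorem comul_duplicate : comul _ ∘ₗ duplicate M =
    TensorProduct.map (duplicate M) (duplicate M) ∘ₗ comul _ := by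
  rw [duplicate, TensorProduct.map_comp, LinearMap.comp_assoc, ← comul_map,
    ← LinearMap.comp_assoc, ← LinearMap.comp_assoc]
  congr 1
  exact LinearMap.ext (comul_cumulantHom _)

theorem proj_duplicate (x : GSym (trivialGrading M)) :
    proj _ (duplicate M x) = x - counit _ x • 1 := by
  rw [duplicate, LinearMap.comp_apply, proj_cumulantHom, AlgHom.toLinearMap_apply, counit_map]
  congr 1
  suffices (mulMap _).comp (map (trivialGrading M) (trivialGrading (GSym (trivialGrading M)))
    (ι (trivialGrading M)) (map_mem_trivialGrading _)) = AlgHom.id ℂ _ from AlgHom.congr_fun this x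
  apply hom_ext
  intro v
  simp [mulMap]

end GSym

namespace Forms

theorem inl_mul_inl (p q : ℂ[X]) : (inl p * inl q : Forms) = inl (p * q) :=
  (TrivSqZeroExt.inl_mul ℂ[X] p q).symm

theorem inl_mul_inr (p q : ℂ[X]) : (inl p * inr q : Forms) = inr (p * q) :=
  TrivSqZeroExt.inl_mul_inr p q

theorem inr_mul_inl (p q : ℂ[X]) : (inr p * inl q : Forms) = inr (p * q) := by
  rw [mul_comm, inl_mul_inr, mul_comm]

theorem inr_mul_inr (p q : ℂ[X]) : (inr p * inr q : Forms) = 0 :=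
  TrivSqZeroExt.inr_mul_inr ℂ[X] p q

theorem d_inl (p : ℂ[X]) : d (inl p) = inr (Polynomial.derivative p) := rfl

theorem d_inr (p : ℂ[X]) : d (inr p) = 0 := by
  simp [d, -DualNumber.inr_eq_smul_eps]

end Forms

namespace GSymForms

variable {V : Type*} [AddCommGroup V] [Module ℂ V] (𝒱 : ℤ → Submodule ℂ V)

/-- The homogeneous tensors of total degree zero in `Ŝ V ⊗ ℂ[t, dt]`. -/
def zeroTensors : Set (GSym 𝒱 ⊗[ℂ] Forms) :=
  {w | (∃ x ∈ GSym.degree 𝒱 0, ∃ p : ℂ[X], w = x ⊗ₜ inl p) ∨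
    ∃ x ∈ GSym.degree 𝒱 (-1), ∃ q : ℂ[X], w = x ⊗ₜ inr q}

/-- The part of total degree zero of `Ŝ V ⊗ ℂ[t, dt]`. -/
def degreeZero : Submodule ℂ (GSym 𝒱 ⊗[ℂ] Forms) := Submodule.span ℂ (zeroTensors 𝒱)

/-- Multiplication by `v ⊗ ω` from the left, up to the sign in front of the second factor. -/
def act (v : V) (ω : Forms) : Module.End ℂ (GSym 𝒱 ⊗[ℂ] Forms) :=
  TensorProduct.map (LinearMap.mulLeft ℂ (GSym.ι 𝒱 v)) (LinearMap.mulLeft ℂ ω)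

@[simp] theorem act_tmul (v : V) (ω : Forms) (x : GSym 𝒱) (η : Forms) :
    act 𝒱 v ω (x ⊗ₜ η) = (GSym.ι 𝒱 v * x) ⊗ₜ (ω * η) := rfl

theorem act_add (v w : V) (ω : Forms) : act 𝒱 (v + w) ω = act 𝒱 v ω + act 𝒱 w ω := by
  ext; simp [add_mul, TensorProduct.add_tmul]

theorem act_smul (c : ℂ) (v : V) (ω : Forms) : act 𝒱 (c • v) ω = c • act 𝒱 v ω := by
  ext; simp [TensorProduct.smul_tmul']

theorem act_zero (ω : Forms) : act 𝒱 0 ω = 0 := by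
  ext; simp

theorem act_neg (v : V) (ω : Forms) : act 𝒱 (-v) ω = -act 𝒱 v ω := by
  ext; simp [TensorProduct.neg_tmul]

theorem act_comm {i : ℤ} {v u : V} (hv : v ∈ 𝒱 0) (hu : u ∈ 𝒱 i) (ω η : Forms) :
    act 𝒱 v ω * act 𝒱 u η = act 𝒱 u η * act 𝒱 v ω := by
  have := GSym.ι_comm 𝒱 hv hu
  rw [zero_mul, zpow_zero, one_smul] at this
  ext x θ
  simp [← mul_assoc, this, mul_comm ω η]

theorem act_inr_mul_act_inr (v u : V) (p q : ℂ[X]) : act 𝒱 v (inr p) * act 𝒱 u (inr q) = 0 := by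
  ext x θ
  simp [-DualNumber.inr_eq_smul_eps, ← mul_assoc]

variable [DirectSum.Decomposition 𝒱]

theorem one_mem_degreeZero : (1 ⊗ₜ 1 : GSym 𝒱 ⊗[ℂ] Forms) ∈ degreeZero 𝒱 :=
  Submodule.subset_span (Or.inl ⟨1, SetLike.GradedOne.one_mem, 1, rfl⟩)

theorem act_inl_mem {v : V} (hv : v ∈ 𝒱 0) (p : ℂ[X]) {w : GSym 𝒱 ⊗[ℂ] Forms}
    (hw : w ∈ degreeZero 𝒱) : act 𝒱 v (inl p) w ∈ degreeZero 𝒱 := by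
  suffices degreeZero 𝒱 ≤ (degreeZero 𝒱).comap (act 𝒱 v (inl p)) from this hw
  conv_lhs => rw [degreeZero]
  rw [Submodule.span_le]
  rintro _ (⟨x, hx, q, rfl⟩ | ⟨x, hx, q, rfl⟩)
  · have := GSym.ι_mul_mem_degree 𝒱 hv hx
    rw [zero_add] at this
    rw [Submodule.comap_coe, Set.mem_preimage, act_tmul, Forms.inl_mul_inl]
    exact Submodule.subset_span (Or.inl ⟨_, this, p * q, rfl⟩)
  · have := GSym.ι_mul_mem_degree 𝒱 hv hx
    rw [zero_add] at this
    rw [Submodule.comap_coe, Set.mem_preimage, act_tmul, Forms.inl_mul_inr]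
    exact Submodule.subset_span (Or.inr ⟨_, this, p * q, rfl⟩)

theorem act_inr_mem {v : V} (hv : v ∈ 𝒱 (-1)) (p : ℂ[X]) {w : GSym 𝒱 ⊗[ℂ] Forms}
    (hw : w ∈ degreeZero 𝒱) : act 𝒱 v (inr p) w ∈ degreeZero 𝒱 := by
  suffices degreeZero 𝒱 ≤ (degreeZero 𝒱).comap (act 𝒱 v (inr p)) from this hw
  conv_lhs => rw [degreeZero]
  rw [Submodule.span_le]
  rintro _ (⟨x, hx, q, rfl⟩ | ⟨x, hx, q, rfl⟩)
  · have := GSym.ι_mul_mem_degree 𝒱 hv hx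
    rw [add_zero] at this
    rw [Submodule.comap_coe, Set.mem_preimage, act_tmul, Forms.inr_mul_inl]
    exact Submodule.subset_span (Or.inr ⟨_, this, p * q, rfl⟩)
  · rw [Submodule.comap_coe, Set.mem_preimage, act_tmul, Forms.inr_mul_inr, TensorProduct.tmul_zero]
    exact zero_mem _

theorem degreeZero_ext {Z : Type*} [AddCommMonoid Z] [Module ℂ Z]
    {f g : GSym 𝒱 ⊗[ℂ] Forms →ₗ[ℂ] Z} (h : ∀ a ∈ zeroTensors 𝒱, f a = g a)
    {w : GSym 𝒱 ⊗[ℂ] Forms} (hw : w ∈ degreeZero 𝒱) : f w = g w := by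
  suffices degreeZero 𝒱 ≤ LinearMap.eqLocus f g from this hw
  rw [degreeZero, Submodule.span_le]
  exact h

section Differential

/-- The differential `a ⊗ ω ↦ D a ⊗ ω + (-1)^|a| a ⊗ dω` of `Ŝ V ⊗ ℂ[t, dt]`, for the coderivation
`D` extending `d`. -/
def differential (d : V →ₗ[ℂ] V) : GSym 𝒱 ⊗[ℂ] Forms →ₗ[ℂ] GSym 𝒱 ⊗[ℂ] Forms :=
  TensorProduct.map (GSym.coderiv 𝒱 d) LinearMap.id +
    TensorProduct.map (signTwist (GSym.degree 𝒱) 1) Forms.d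

theorem differential_tmul (d : V →ₗ[ℂ] V) (x : GSym 𝒱) (ω : Forms) : differential 𝒱 d (x ⊗ₜ ω) =
    GSym.coderiv 𝒱 d x ⊗ₜ ω + signTwist (GSym.degree 𝒱) 1 x ⊗ₜ Forms.d ω := rfl

variable {d : V →ₗ[ℂ] V} (hd : ∀ i, ∀ v ∈ 𝒱 i, d v ∈ 𝒱 (i + 1))
include hd

theorem differential_act_inl {v : V} (hv : v ∈ 𝒱 0) (p : ℂ[X]) {w : GSym 𝒱 ⊗[ℂ] Forms}
    (hw : w ∈ degreeZero 𝒱) : differential 𝒱 d (act 𝒱 v (inl p) w) =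
      act 𝒱 (d v) (inl p) w + act 𝒱 v (inr (Polynomial.derivative p)) w +
        act 𝒱 v (inl p) (differential 𝒱 d w) := by
  refine degreeZero_ext 𝒱 (f := differential 𝒱 d ∘ₗ act 𝒱 v (inl p))
    (g := act 𝒱 (d v) (inl p) + act 𝒱 v (inr (Polynomial.derivative p)) +
        act 𝒱 v (inl p) ∘ₗ differential 𝒱 d) ?_ hw
  rintro _ (⟨x, hx, q, rfl⟩ | ⟨x, hx, q, rfl⟩)
  · have hs := signTwist_of_mem (GSym.degree 𝒱) 1 hx
    simp only [mul_zero, zpow_zero, one_smul] at hs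
    simp only [LinearMap.comp_apply, LinearMap.add_apply, differential_tmul, act_tmul, map_add,
      Forms.inl_mul_inl, Forms.inl_mul_inr, Forms.inr_mul_inl, Forms.d_inl, hs,
      GSym.coderiv_ι_mul 𝒱 hd hv, GSym.signTwist_ι_mul 𝒱 1 hv, mul_zero, zpow_zero, one_smul,
      Polynomial.derivative_mul, TrivSqZeroExt.inr_add, TensorProduct.add_tmul,
      TensorProduct.tmul_add]
    abel
  · simp only [LinearMap.comp_apply, LinearMap.add_apply, differential_tmul, act_tmul,
      Forms.inl_mul_inr, Forms.inr_mul_inr, Forms.d_inr, mul_zero, zpow_zero, one_smul,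
      GSym.coderiv_ι_mul 𝒱 hd hv, TensorProduct.add_tmul, TensorProduct.tmul_zero, add_zero]

theorem differential_act_inr {v : V} (hv : v ∈ 𝒱 (-1)) (p : ℂ[X]) {w : GSym 𝒱 ⊗[ℂ] Forms}
    (hw : w ∈ degreeZero 𝒱) : differential 𝒱 d (act 𝒱 v (inr p) w) =
      act 𝒱 (d v) (inr p) w - act 𝒱 v (inr p) (differential 𝒱 d w) := by
  refine degreeZero_ext 𝒱 (f := differential 𝒱 d ∘ₗ act 𝒱 v (inr p))
    (g := act 𝒱 (d v) (inr p) - act 𝒱 v (inr p) ∘ₗ differential 𝒱 d) ?_ hw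
  have h1 : (-1 : ℂ) ^ (1 * (-1) : ℤ) = -1 := by norm_num
  rintro _ (⟨x, hx, q, rfl⟩ | ⟨x, hx, q, rfl⟩) <;>
  simp only [LinearMap.comp_apply, LinearMap.sub_apply, differential_tmul, act_tmul, map_add,
      Forms.inr_mul_inl, Forms.inr_mul_inr, Forms.d_inl, Forms.d_inr,
      GSym.coderiv_ι_mul 𝒱 hd hv, h1, neg_smul, one_smul, TensorProduct.add_tmul,
      TensorProduct.neg_tmul, TensorProduct.tmul_zero, add_zero, sub_eq_add_neg, map_zero, neg_zero]

end Differential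

section Coproduct

/-- The canonical map from `(Ŝ V ⊗ ℂ[t, dt]) ⊗ (Ŝ V ⊗ ℂ[t, dt])` to the tensor product over
`ℂ[t, dt]`, without signs. -/
def toRelTensor : (GSym 𝒱 ⊗[ℂ] Forms) ⊗[ℂ] (GSym 𝒱 ⊗[ℂ] Forms) →ₗ[ℂ]
    (GSym 𝒱 ⊗[ℂ] GSym 𝒱) ⊗[ℂ] Forms :=
  TensorProduct.map LinearMap.id (LinearMap.mul' ℂ Forms) ∘ₗ
    (TensorProduct.tensorTensorTensorComm ℂ (GSym 𝒱) Forms (GSym 𝒱) Forms).toLinearMap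

@[simp] theorem toRelTensor_tmul (x y : GSym 𝒱) (ω η : Forms) :
    toRelTensor 𝒱 ((x ⊗ₜ ω) ⊗ₜ (y ⊗ₜ η)) = (x ⊗ₜ y) ⊗ₜ (ω * η) := rfl

/-- The span of the tensors of two elements of total degree zero. -/
def degreeZeroTensors : Submodule ℂ ((GSym 𝒱 ⊗[ℂ] Forms) ⊗[ℂ] (GSym 𝒱 ⊗[ℂ] Forms)) :=
  Submodule.map₂ (TensorProduct.mk ℂ _ _) (degreeZero 𝒱) (degreeZero 𝒱)

theorem degreeZeroTensors_ext {Z : Type*} [AddCommMonoid Z] [Module ℂ Z]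
    {f g : (GSym 𝒱 ⊗[ℂ] Forms) ⊗[ℂ] (GSym 𝒱 ⊗[ℂ] Forms) →ₗ[ℂ] Z}
    (h : ∀ a ∈ zeroTensors 𝒱, ∀ b ∈ zeroTensors 𝒱, f (a ⊗ₜ b) = g (a ⊗ₜ b))
    {w : (GSym 𝒱 ⊗[ℂ] Forms) ⊗[ℂ] (GSym 𝒱 ⊗[ℂ] Forms)} (hw : w ∈ degreeZeroTensors 𝒱) :
    f w = g w := by
  suffices degreeZeroTensors 𝒱 ≤ LinearMap.eqLocus f g from this hw
  rw [degreeZeroTensors, degreeZero, Submodule.map₂_span_span, Submodule.span_le]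
  rintro _ ⟨a, ha, b, hb, rfl⟩
  exact h a ha b hb

/-- The coproduct of `Ŝ V ⊗ ℂ[t, dt]`, a coalgebra over `ℂ[t, dt]`. -/
def comul : GSym 𝒱 ⊗[ℂ] Forms →ₗ[ℂ] (GSym 𝒱 ⊗[ℂ] GSym 𝒱) ⊗[ℂ] Forms :=
  TensorProduct.map (GSym.comul 𝒱) LinearMap.id

/-- The extension of an operator on a factor to a primitive operator on the tensor square. -/
def primitive (T : Module.End ℂ (GSym 𝒱 ⊗[ℂ] Forms)) :
    Module.End ℂ ((GSym 𝒱 ⊗[ℂ] Forms) ⊗[ℂ] (GSym 𝒱 ⊗[ℂ] Forms)) :=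
  TensorProduct.map T LinearMap.id + TensorProduct.map LinearMap.id T

theorem primitive_tmul (T : Module.End ℂ (GSym 𝒱 ⊗[ℂ] Forms)) (a b : GSym 𝒱 ⊗[ℂ] Forms) :
    primitive 𝒱 T (a ⊗ₜ b) = T a ⊗ₜ b + a ⊗ₜ T b := rfl

theorem primitive_add (T U : Module.End ℂ (GSym 𝒱 ⊗[ℂ] Forms)) :
    primitive 𝒱 (T + U) = primitive 𝒱 T + primitive 𝒱 U := by
  simp only [primitive, TensorProduct.map_add_left, TensorProduct.map_add_right]
  abel

theorem comul_act {q : ℤ} {v : V} (hv : v ∈ 𝒱 q) (ω : Forms) (w : GSym 𝒱 ⊗[ℂ] Forms) :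
    comul 𝒱 (act 𝒱 v ω w) =
      TensorProduct.map (GSym.consTensor 𝒱 q v) (LinearMap.mulLeft ℂ ω) (comul 𝒱 w) := by
  induction w using TensorProduct.induction_on with
  | zero => simp
  | add a b ha hb => simp only [map_add, ha, hb]
  | tmul x η => simp [comul, GSym.comul_ι_mul 𝒱 hv]

variable {W : (GSym 𝒱 ⊗[ℂ] Forms) ⊗[ℂ] (GSym 𝒱 ⊗[ℂ] Forms)} (hW : W ∈ degreeZeroTensors 𝒱)
  {w : GSym 𝒱 ⊗[ℂ] Forms} (h : comul 𝒱 w = toRelTensor 𝒱 W)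
include hW h

theorem comul_act_inl {v : V} (hv : v ∈ 𝒱 0) (p : ℂ[X]) :
    comul 𝒱 (act 𝒱 v (inl p) w) = toRelTensor 𝒱 (primitive 𝒱 (act 𝒱 v (inl p)) W) := by
  rw [comul_act 𝒱 hv, h]
  refine degreeZeroTensors_ext 𝒱 (f := TensorProduct.map (GSym.consTensor 𝒱 0 v)
    (LinearMap.mulLeft ℂ (inl p : Forms)) ∘ₗ toRelTensor 𝒱) (g := toRelTensor 𝒱 ∘ₗ
    primitive 𝒱 (act 𝒱 v (inl p))) ?_ hW
  have hs : ∀ x, signTwist (GSym.degree 𝒱) 0 x = x := by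
    intro x
    suffices signTwist (GSym.degree 𝒱) 0 = LinearMap.id from LinearMap.congr_fun this x
    exact hom_ext_mem (GSym.degree 𝒱) fun i v hv => by simp [signTwist_of_mem _ _ hv]
  have key : ∀ (x y : GSym 𝒱) (ω η : Forms), (TensorProduct.map (GSym.consTensor 𝒱 0 v)
      (LinearMap.mulLeft ℂ (inl p : Forms)) ∘ₗ toRelTensor 𝒱) ((x ⊗ₜ ω) ⊗ₜ (y ⊗ₜ η)) =
      (toRelTensor 𝒱 ∘ₗ primitive 𝒱 (act 𝒱 v (inl p))) ((x ⊗ₜ ω) ⊗ₜ (y ⊗ₜ η)) := by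
    intro x y ω η
    simp only [LinearMap.comp_apply, primitive_tmul, act_tmul, map_add, toRelTensor_tmul,
      TensorProduct.map_tmul, GSym.consTensor, LinearMap.add_apply, LinearMap.mulLeft_apply,
      LinearMap.id_apply, hs, TensorProduct.add_tmul]
    rw [mul_assoc, mul_left_comm]
  rintro _ (⟨x, hx, q, rfl⟩ | ⟨x, hx, q, rfl⟩) _ (⟨y, hy, r, rfl⟩ | ⟨y, hy, r, rfl⟩) <;>
  exact key _ _ _ _

theorem comul_act_inr {v : V} (hv : v ∈ 𝒱 (-1)) (p : ℂ[X]) :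
    comul 𝒱 (act 𝒱 v (inr p) w) = toRelTensor 𝒱 (primitive 𝒱 (act 𝒱 v (inr p)) W) := by
  rw [comul_act 𝒱 hv, h]
  refine degreeZeroTensors_ext 𝒱 (f := TensorProduct.map (GSym.consTensor 𝒱 (-1) v)
    (LinearMap.mulLeft ℂ (inr p : Forms)) ∘ₗ toRelTensor 𝒱) (g := toRelTensor 𝒱 ∘ₗ
    primitive 𝒱 (act 𝒱 v (inr p))) ?_ hW
  have expand : ∀ (x y : GSym 𝒱) (ω η : Forms), (TensorProduct.map (GSym.consTensor 𝒱 (-1) v)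
      (LinearMap.mulLeft ℂ (inr p : Forms)) ∘ₗ toRelTensor 𝒱) ((x ⊗ₜ ω) ⊗ₜ (y ⊗ₜ η)) =
      ((GSym.ι 𝒱 v * x) ⊗ₜ y) ⊗ₜ (inr p * (ω * η)) +
      (signTwist (GSym.degree 𝒱) (-1) x ⊗ₜ (GSym.ι 𝒱 v * y)) ⊗ₜ (inr p * (ω * η)) := by
    intro x y ω η
    simp only [LinearMap.comp_apply, toRelTensor_tmul,
      TensorProduct.map_tmul, GSym.consTensor, LinearMap.add_apply, LinearMap.mulLeft_apply,
      LinearMap.id_apply, TensorProduct.add_tmul]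
  rintro _ (⟨x, hx, q, rfl⟩ | ⟨x, hx, q, rfl⟩) _ (⟨y, hy, r, rfl⟩ | ⟨y, hy, r, rfl⟩) <;>
  rw [expand] <;>
  simp only [LinearMap.comp_apply, primitive_tmul, act_tmul, map_add, toRelTensor_tmul,
    Forms.inl_mul_inl, Forms.inr_mul_inr, Forms.inl_mul_inr, Forms.inr_mul_inl,
    TensorProduct.tmul_zero, TensorProduct.zero_tmul, map_zero, mul_zero, add_zero, zero_add]
  rw [signTwist_of_mem (GSym.degree 𝒱) (-1) hx, mul_zero, zpow_zero, one_smul, mul_left_comm q,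
    mul_assoc]

end Coproduct

end GSymForms

namespace GSym

variable (N : Type*) [AddCommGroup N] [Module ℂ N]

theorem signTwist_trivialGrading (q : ℤ) :
    signTwist (degree (trivialGrading N)) q = LinearMap.id := by
  apply lhom_ext_cons
  · simp
  · intro i v hv x hx
    by_cases hi : i = 0
    · subst hi
      simp [signTwist_ι_mul _ q hv, hx]
    · simp [eq_zero_of_mem_trivialGrading hi hv]

theorem degree_trivialGrading_zero : degree (trivialGrading N) 0 = ⊤ := by
  apply eq_top_of_cons
  · exact SetLike.GradedOne.one_mem
  · intro i v _ x hx
    simpa using ι_mul_mem_degree _ (mem_trivialGrading_zero v) hx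

theorem eq_zero_of_mem_degree_trivialGrading {k : ℤ} (hk : k ≠ 0) {x : GSym (trivialGrading N)}
    (hx : x ∈ degree (trivialGrading N) k) : x = 0 := by
  refine degree_induction (trivialGrading N) (p := fun k x => k ≠ 0 → x = 0) ?_ ?_ ?_ ?_ ?_ hx hk
  · simp
  · intro i k v hv x _ ih h
    by_cases hi : i = 0
    · rw [ih (by omega), mul_zero]
    · rw [eq_zero_of_mem_trivialGrading hi hv, map_zero, zero_mul]
  · simp
  · intro k x y hx hy h
    rw [hx h, hy h, add_zero]
  · intro k c x hx h
    rw [hx h, smul_zero]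

end GSym

/-- A linear map `N → V ⊗ ℂ[t, dt]`, `a ↦ x a + z a t + s a dt`, of total degree zero, for `N` in
degree zero. -/
structure AffineHomotopy {V : Type*} [AddCommGroup V] [Module ℂ V] (𝒱 : ℤ → Submodule ℂ V)
    (N : Type*) [AddCommGroup N] [Module ℂ N] where
  base : N →ₗ[ℂ] V
  slope : N →ₗ[ℂ] V
  form : N →ₗ[ℂ] V
  base_mem : ∀ a, base a ∈ 𝒱 0
  slope_mem : ∀ a, slope a ∈ 𝒱 0
  form_mem : ∀ a, form a ∈ 𝒱 (-1)

namespace AffineHomotopy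

variable {V : Type*} [AddCommGroup V] [Module ℂ V] {𝒱 : ℤ → Submodule ℂ V}
  {N : Type*} [AddCommGroup N] [Module ℂ N] (h : AffineHomotopy 𝒱 N)

/-- The operator of multiplication by `x a + z a t + s a dt`. -/
def operator : N →ₗ[ℂ] Module.End ℂ (GSym 𝒱 ⊗[ℂ] Forms) where
  toFun a := GSymForms.act 𝒱 (h.base a) (inl 1) + GSymForms.act 𝒱 (h.slope a) (inl Polynomial.X) +
    GSymForms.act 𝒱 (h.form a) (inr 1)
  map_add' a b := by simp only [map_add, GSymForms.act_add]; abel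
  map_smul' c a := by simp only [map_smul, GSymForms.act_smul, smul_add, RingHom.id_apply]

theorem operator_apply (a : N) : h.operator a = GSymForms.act 𝒱 (h.base a) (inl 1) +
    GSymForms.act 𝒱 (h.slope a) (inl Polynomial.X) + GSymForms.act 𝒱 (h.form a) (inr 1) := rfl

theorem operator_comm (a b : N) : h.operator a * h.operator b = h.operator b * h.operator a := by
  simp only [operator_apply, mul_add, add_mul, GSymForms.act_inr_mul_act_inr,
    GSymForms.act_comm 𝒱 (h.base_mem a) (h.base_mem b),
    GSymForms.act_comm 𝒱 (h.base_mem a) (h.slope_mem b),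
    GSymForms.act_comm 𝒱 (h.base_mem a) (h.form_mem b),
    GSymForms.act_comm 𝒱 (h.slope_mem a) (h.base_mem b),
    GSymForms.act_comm 𝒱 (h.slope_mem a) (h.slope_mem b),
    GSymForms.act_comm 𝒱 (h.slope_mem a) (h.form_mem b),
    ← GSymForms.act_comm 𝒱 (h.base_mem b) (h.form_mem a),
    ← GSymForms.act_comm 𝒱 (h.slope_mem b) (h.form_mem a)]
  abel

/-- The action of `Ŝ N` on `Ŝ V ⊗ ℂ[t, dt]` by the operators of multiplication. -/
def operatorHom : GSym (trivialGrading N) →ₐ[ℂ] Module.End ℂ (GSym 𝒱 ⊗[ℂ] Forms) :=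
  GSym.lift (trivialGrading N) (A := Module.End ℂ (GSym 𝒱 ⊗[ℂ] Forms)) h.operator (by
    intro i j a ha b hb
    by_cases hi : i = 0
    · subst hi; simpa using h.operator_comm a b
    · simp [eq_zero_of_mem_trivialGrading hi ha])

/-- The multiplicative extension `Ŝ N → Ŝ V ⊗ ℂ[t, dt]`. -/
def lift : GSym (trivialGrading N) →ₗ[ℂ] GSym 𝒱 ⊗[ℂ] Forms :=
  LinearMap.applyₗ (1 ⊗ₜ 1 : GSym 𝒱 ⊗[ℂ] Forms) ∘ₗ h.operatorHom.toLinearMap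

@[simp] theorem lift_one : h.lift 1 = 1 ⊗ₜ 1 := by simp [lift, operatorHom]

theorem lift_ι_mul (a : N) (x : GSym (trivialGrading N)) :
    h.lift (GSym.ι (trivialGrading N) a * x) = h.operator a (h.lift x) := by simp [lift, operatorHom]

variable [DirectSum.Decomposition 𝒱]

theorem lift_mem (x : GSym (trivialGrading N)) : h.lift x ∈ GSymForms.degreeZero 𝒱 := by
  suffices (GSymForms.degreeZero 𝒱).comap h.lift = ⊤ by
    rw [← Submodule.mem_comap, this]; trivial
  apply GSym.eq_top_of_cons
  · rw [Submodule.mem_comap, lift_one]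
    exact GSymForms.one_mem_degreeZero 𝒱
  · intro i a _ x hx
    rw [Submodule.mem_comap] at hx ⊢
    rw [lift_ι_mul, operator_apply]
    exact add_mem (add_mem (GSymForms.act_inl_mem 𝒱 (h.base_mem a) _ hx)
      (GSymForms.act_inl_mem 𝒱 (h.slope_mem a) _ hx)) (GSymForms.act_inr_mem 𝒱 (h.form_mem a) _ hx)

theorem differential_lift {d : V →ₗ[ℂ] V} (hd : ∀ i, ∀ v ∈ 𝒱 i, d v ∈ 𝒱 (i + 1))
    (hb : ∀ a, d (h.base a) = 0) (hf : ∀ a, d (h.form a) = -h.slope a)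
    (hs : ∀ a, d (h.slope a) = 0) :
    GSymForms.differential 𝒱 d ∘ₗ h.lift = 0 := by
  apply GSym.lhom_ext_cons
  · rw [LinearMap.comp_apply, lift_one, GSymForms.differential_tmul, GSym.coderiv_one]
    have : Forms.d 1 = 0 := by
      rw [← TrivSqZeroExt.inl_one, Forms.d_inl, Polynomial.derivative_one, TrivSqZeroExt.inr_zero]
    simp [this]
  · intro i a _ x hx
    simp only [LinearMap.comp_apply, LinearMap.zero_apply] at hx ⊢
    rw [lift_ι_mul, operator_apply]
    have hx' := h.lift_mem x
    have h0 : GSymForms.act 𝒱 (h.base a) (inr 0) = 0 := by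
      rw [TrivSqZeroExt.inr_zero]
      ext; simp
    simp only [LinearMap.add_apply, map_add, GSymForms.differential_act_inl 𝒱 hd (h.base_mem a) _ hx',
      GSymForms.differential_act_inl 𝒱 hd (h.slope_mem a) _ hx',
      GSymForms.differential_act_inr 𝒱 hd (h.form_mem a) _ hx', hx, hb, hf, hs,
      GSymForms.act_neg, GSymForms.act_zero, Polynomial.derivative_one, Polynomial.derivative_X, h0,
      map_zero, LinearMap.zero_apply, LinearMap.neg_apply]
    abel

theorem comul_lift : GSymForms.comul 𝒱 ∘ₗ h.lift = GSymForms.toRelTensor 𝒱 ∘ₗ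
    TensorProduct.map h.lift h.lift ∘ₗ GSym.comul (trivialGrading N) := by
  apply GSym.lhom_ext_cons
  · simp [GSym.comul_one, GSymForms.comul]
  · intro i a ha x hx
    simp only [LinearMap.comp_apply] at hx ⊢
    have hW : TensorProduct.map h.lift h.lift (GSym.comul (trivialGrading N) x) ∈
        GSymForms.degreeZeroTensors 𝒱 := by
      generalize GSym.comul (trivialGrading N) x = y
      induction y using TensorProduct.induction_on with
      | zero => simp
      | add a b ha hb => rw [map_add]; exact add_mem ha hb
      | tmul a b => exact Submodule.apply_mem_map₂ _ (h.lift_mem a) (h.lift_mem b)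
    have key : TensorProduct.map h.lift h.lift ∘ₗ GSym.consTensor (trivialGrading N) i a =
        GSymForms.primitive 𝒱 (h.operator a) ∘ₗ TensorProduct.map h.lift h.lift := by
      ext x y
      simp [GSym.consTensor, GSym.signTwist_trivialGrading, GSymForms.primitive_tmul, lift_ι_mul]
    have := LinearMap.congr_fun key (GSym.comul (trivialGrading N) x)
    simp only [LinearMap.comp_apply] at this
    rw [GSym.comul_ι_mul _ ha, this, lift_ι_mul, operator_apply, GSymForms.primitive_add,
      GSymForms.primitive_add]
    simp only [LinearMap.add_apply, map_add,
      GSymForms.comul_act_inl 𝒱 hW hx (h.base_mem a), GSymForms.comul_act_inl 𝒱 hW hx (h.slope_mem a),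
      GSymForms.comul_act_inr 𝒱 hW hx (h.form_mem a)]

theorem eval_mem (c : ℂ) (i : ℤ) (a : N) (ha : a ∈ trivialGrading N i) :
    (h.base + c • h.slope) a ∈ 𝒱 i := by
  by_cases hi : i = 0
  · subst hi
    exact add_mem (h.base_mem a) (Submodule.smul_mem _ _ (h.slope_mem a))
  · rw [eq_zero_of_mem_trivialGrading hi ha, map_zero]; exact zero_mem _

theorem eval_lift (c : ℂ) (x : GSym (trivialGrading N)) :
    TensorProduct.rid ℂ _ (TensorProduct.map LinearMap.id (Forms.eval c) (h.lift x)) =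
      GSym.map (trivialGrading N) 𝒱 (h.base + c • h.slope) (h.eval_mem c) x := by
  suffices (TensorProduct.rid ℂ _).toLinearMap ∘ₗ
      TensorProduct.map LinearMap.id (Forms.eval c) ∘ₗ h.lift =
      (GSym.map (trivialGrading N) 𝒱 (h.base + c • h.slope) (h.eval_mem c)).toLinearMap from
    LinearMap.congr_fun this x
  have hact : ∀ (v : V) (ω : Forms) (w : GSym 𝒱 ⊗[ℂ] Forms),
      TensorProduct.rid ℂ _ (TensorProduct.map LinearMap.id (Forms.eval c)
        (GSymForms.act 𝒱 v ω w)) = Forms.eval c ω • (GSym.ι 𝒱 v *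
      TensorProduct.rid ℂ _ (TensorProduct.map LinearMap.id (Forms.eval c) w)) := by
    intro v ω w
    induction w using TensorProduct.induction_on with
    | zero => simp
    | add a b ha hb => simp only [map_add, ha, hb, mul_add, smul_add]
    | tmul x η => simp [Forms.eval, smul_smul]
  have e1 : Forms.eval c (inl 1) = 1 := by simp [Forms.eval]
  have e2 : Forms.eval c (inl Polynomial.X) = c := by simp [Forms.eval]
  have e3 : Forms.eval c (inr 1) = 0 := by simp [Forms.eval]
  apply GSym.lhom_ext_cons
  · simp [Forms.eval]
  · intro i a _ x hx
    simp only [LinearMap.comp_apply, LinearEquiv.coe_coe, AlgHom.toLinearMap_apply] at hx ⊢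
    rw [lift_ι_mul, operator_apply, map_mul, ← hx]
    simp only [LinearMap.add_apply, map_add, hact, e1, e2, e3, GSym.map_ι, add_mul, one_smul,
      zero_smul, add_zero, LinearMap.smul_apply, map_smul, smul_mul_assoc]

end AffineHomotopy

namespace SymForms

variable {V : Type*} [AddCommGroup V] [Module ℂ V] (𝒱 : ℤ → Submodule ℂ V)
  [DirectSum.Decomposition 𝒱]

/-- The projection `Ŝ V ⊗ ℂ[t, dt] → S V ⊗ ℂ[t, dt]`. -/
def reduce : GSym 𝒱 ⊗[ℂ] Forms →ₗ[ℂ] SymCoalg 𝒱 ⊗[ℂ] Forms :=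
  TensorProduct.map (SymCoalg.reduce 𝒱) LinearMap.id

theorem comul_comp_reduce : comul 𝒱 ∘ₗ reduce 𝒱 =
    TensorProduct.map (TensorProduct.map (SymCoalg.reduce 𝒱) (SymCoalg.reduce 𝒱)) LinearMap.id ∘ₗ
      GSymForms.comul 𝒱 := by
  rw [comul, reduce, GSymForms.comul, ← TensorProduct.map_comp, ← TensorProduct.map_comp,
    SymCoalg.comul_comp_reduce]

theorem toRelTensor_reduce {W : (GSym 𝒱 ⊗[ℂ] Forms) ⊗[ℂ] (GSym 𝒱 ⊗[ℂ] Forms)}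
    (hW : W ∈ GSymForms.degreeZeroTensors 𝒱) :
    toRelTensor 𝒱 (TensorProduct.map (reduce 𝒱) (reduce 𝒱) W) =
      TensorProduct.map (TensorProduct.map (SymCoalg.reduce 𝒱) (SymCoalg.reduce 𝒱)) LinearMap.id
        (GSymForms.toRelTensor 𝒱 W) := by
  refine GSymForms.degreeZeroTensors_ext 𝒱
    (f := toRelTensor 𝒱 ∘ₗ
    TensorProduct.map (reduce 𝒱) (reduce 𝒱)) (g := TensorProduct.map
    (TensorProduct.map (SymCoalg.reduce 𝒱) (SymCoalg.reduce 𝒱)) LinearMap.id ∘ₗ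
        GSymForms.toRelTensor 𝒱) ?_ hW
  have expand : ∀ (x y : GSym 𝒱) (ω η : Forms), (toRelTensor 𝒱 ∘ₗ
      TensorProduct.map (reduce 𝒱) (reduce 𝒱)) ((x ⊗ₜ ω) ⊗ₜ (y ⊗ₜ η)) =
      (SymCoalg.reduce 𝒱 x ⊗ₜ SymCoalg.reduce 𝒱 y) ⊗ₜ (Forms.even ω * η) +
      (SymCoalg.reduce 𝒱 x ⊗ₜ SymCoalg.reduce 𝒱 (signTwist (GSym.degree 𝒱) 1 y)) ⊗ₜ
        (Forms.odd ω * η) := by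
    intro x y ω η
    simp [toRelTensor, reduce, SymCoalg.parity_reduce]
  have expand' : ∀ (x y : GSym 𝒱) (ω η : Forms), (TensorProduct.map
      (TensorProduct.map (SymCoalg.reduce 𝒱) (SymCoalg.reduce 𝒱)) LinearMap.id ∘ₗ
      GSymForms.toRelTensor 𝒱) ((x ⊗ₜ ω) ⊗ₜ (y ⊗ₜ η)) =
      (SymCoalg.reduce 𝒱 x ⊗ₜ SymCoalg.reduce 𝒱 y) ⊗ₜ (ω * η) := fun x y ω η => rfl
  have e1 : ∀ p, Forms.even (inl p) = inl p := fun p => rfl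
  have e2 : ∀ p, Forms.odd (inl p) = 0 := fun p => TrivSqZeroExt.inr_zero ℂ[X]
  have e3 : ∀ p, Forms.even (inr p) = 0 := fun p => TrivSqZeroExt.inl_zero ℂ[X]
  have e4 : ∀ p, Forms.odd (inr p) = inr p := fun p => rfl
  rintro _ (⟨x, hx, q, rfl⟩ | ⟨x, hx, q, rfl⟩) _ (⟨y, hy, r, rfl⟩ | ⟨y, hy, r, rfl⟩) <;>
  rw [expand, expand'] <;>
  simp only [e1, e2, e3, e4, zero_mul, TensorProduct.tmul_zero, add_zero, zero_add,
    Forms.inr_mul_inr]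
  rw [signTwist_of_mem _ _ hy, mul_zero, zpow_zero, one_smul]

theorem differential_reduce (d : V →ₗ[ℂ] V) :
    differential 𝒱 (SymCoalg.extend 𝒱 d) ∘ₗ reduce 𝒱 = reduce 𝒱 ∘ₗ GSymForms.differential 𝒱 d := by
  ext1
  ext1 x
  ext1 ω
  simp [differential, reduce, GSymForms.differential, SymCoalg.parity_reduce, SymCoalg.extend_reduce]

theorem eval_reduce (c : ℂ) (w : GSym 𝒱 ⊗[ℂ] Forms) : eval 𝒱 c (reduce 𝒱 w) =
    SymCoalg.reduce 𝒱 (TensorProduct.rid ℂ _ (TensorProduct.map LinearMap.id (Forms.eval c) w)) := by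
  induction w using TensorProduct.induction_on with
  | zero => simp
  | add a b ha hb => simp only [map_add, ha, hb]
  | tmul x ω => simp [eval, reduce]

theorem reduce_mem_degree {x : GSym 𝒱} {k : ℤ} (hx : x ∈ GSym.degree 𝒱 k) :
    SymCoalg.reduce 𝒱 x ∈ SymCoalg.degree 𝒱 k := by
  change (SymCoalg.reduce 𝒱 x : GSym 𝒱) ∈ GSym.degree 𝒱 k
  rw [SymCoalg.coe_reduce]
  by_cases hk : k = 0
  · subst hk
    exact sub_mem hx (Submodule.smul_mem _ _ SetLike.GradedOne.one_mem)
  · rwa [GSym.counit_of_mem_degree 𝒱 hk hx, zero_smul, sub_zero]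

theorem map_reduce_mem_degree {ψ : SymCoalg 𝒱 →ₗ[ℂ] SymCoalg 𝒱}
    (hψ : ∀ k, ∀ x ∈ SymCoalg.degree 𝒱 k, ψ x ∈ SymCoalg.degree 𝒱 k) {w : GSym 𝒱 ⊗[ℂ] Forms}
    (hw : w ∈ GSymForms.degreeZero 𝒱) :
    TensorProduct.map ψ LinearMap.id (reduce 𝒱 w) ∈ degree 𝒱 0 := by
  suffices GSymForms.degreeZero 𝒱 ≤
    (degree 𝒱 0).comap (TensorProduct.map ψ LinearMap.id ∘ₗ reduce 𝒱) from this hw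
  rw [GSymForms.degreeZero, Submodule.span_le]
  rintro _ (⟨x, hx, q, rfl⟩ | ⟨x, hx, q, rfl⟩)
  · refine Submodule.mem_iSup_of_mem 0 (Submodule.apply_mem_map₂ _ ?_ ?_)
    · rw [sub_zero]
      exact hψ _ _ (reduce_mem_degree 𝒱 hx)
    · rw [Forms.degree, if_pos rfl]
      exact ⟨inl q, rfl⟩
  · refine Submodule.mem_iSup_of_mem 1 (Submodule.apply_mem_map₂ _ ?_ ?_)
    · rw [zero_sub]
      exact hψ _ _ (reduce_mem_degree 𝒱 hx)
    · rw [Forms.degree, if_neg one_ne_zero, if_pos rfl]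
      exact ⟨inr q, rfl⟩

section Map

variable {𝒱} {ψ : SymCoalg 𝒱 →ₗ[ℂ] SymCoalg 𝒱}

theorem comul_map (hψ : IsCoalgHom 𝒱 𝒱 ψ) :
    comul 𝒱 ∘ₗ TensorProduct.map ψ LinearMap.id =
      TensorProduct.map (TensorProduct.map ψ ψ) LinearMap.id ∘ₗ comul 𝒱 := by
  rw [comul, ← TensorProduct.map_comp, ← TensorProduct.map_comp, hψ]

theorem toRelTensor_map (hψ : SymCoalg.parity 𝒱 ∘ₗ ψ = ψ ∘ₗ SymCoalg.parity 𝒱) :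
    toRelTensor 𝒱 ∘ₗ TensorProduct.map (TensorProduct.map ψ LinearMap.id)
      (TensorProduct.map ψ LinearMap.id) =
      TensorProduct.map (TensorProduct.map ψ ψ) LinearMap.id ∘ₗ toRelTensor 𝒱 := by
  have hψ' : ∀ x, SymCoalg.parity 𝒱 (ψ x) = ψ (SymCoalg.parity 𝒱 x) := LinearMap.congr_fun hψ
  apply TensorProduct.ext_fourfold'
  intro x ω y η
  simp [toRelTensor, hψ']

theorem differential_map {D D' : SymCoalg 𝒱 →ₗ[ℂ] SymCoalg 𝒱}
    (hψ : SymCoalg.parity 𝒱 ∘ₗ ψ = ψ ∘ₗ SymCoalg.parity 𝒱) (hD : D' ∘ₗ ψ = ψ ∘ₗ D) :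
    differential 𝒱 D' ∘ₗ TensorProduct.map ψ LinearMap.id =
      TensorProduct.map ψ LinearMap.id ∘ₗ differential 𝒱 D := by
  simp only [differential, LinearMap.add_comp, LinearMap.comp_add, ← TensorProduct.map_comp, hD, hψ,
    LinearMap.id_comp, LinearMap.comp_id]

theorem eval_map (c : ℂ) : eval 𝒱 c ∘ₗ TensorProduct.map ψ LinearMap.id = ψ ∘ₗ eval 𝒱 c := by
  apply TensorProduct.ext'
  intro x ω
  simp [eval]

end Map

end SymForms

namespace SymCoalg

variable {A : Type*} [Ring A] [Algebra ℂ A] (𝒜 : ℤ → Submodule ℂ A) [GradedAlgebra 𝒜]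
  [GradedCommutative 𝒜]

theorem cumulantMap_mem_degree {k : ℤ} {x : SymCoalg 𝒜} (hx : x ∈ degree 𝒜 k) :
    cumulantMap 𝒜 x ∈ degree 𝒜 k :=
  GSym.cumulantHom_mem_degree 𝒜 hx

theorem cumulantMap_symm_mem_degree {k : ℤ} {x : SymCoalg 𝒜} (hx : x ∈ degree 𝒜 k) :
    (cumulantMap 𝒜).symm x ∈ degree 𝒜 k := by
  obtain ⟨y, rfl⟩ := (cumulantMap 𝒜).surjective x
  rw [LinearEquiv.symm_apply_apply]
  exact GSym.mem_degree_of_cumulantHom_mem 𝒜 hx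

theorem parity_cumulantMap (x : SymCoalg 𝒜) :
    parity 𝒜 (cumulantMap 𝒜 x) = cumulantMap 𝒜 (parity 𝒜 x) :=
  Subtype.ext (GSym.signTwist_cumulantHom 𝒜 1 x)

theorem parity_cumulantMap_symm (x : SymCoalg 𝒜) :
    parity 𝒜 ((cumulantMap 𝒜).symm x) = (cumulantMap 𝒜).symm (parity 𝒜 x) := by
  rw [LinearEquiv.eq_symm_apply, ← parity_cumulantMap, LinearEquiv.apply_symm_apply]

theorem isCoalgHom_cumulantMap_symm : IsCoalgHom 𝒜 𝒜 (cumulantMap 𝒜).symm.toLinearMap := by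
  ext1 x
  obtain ⟨y, rfl⟩ := (cumulantMap 𝒜).surjective x
  have := LinearMap.congr_fun (isCoalgHom_cumulantMap 𝒜) y
  simp only [LinearMap.comp_apply, LinearEquiv.coe_coe] at this ⊢
  rw [this, LinearEquiv.symm_apply_apply, TensorProduct.map_map]
  simp

theorem cumulantMap_comp_transport (f : SymCoalg 𝒜 →ₗ[ℂ] SymCoalg 𝒜) :
    (cumulantMap 𝒜).toLinearMap ∘ₗ transport 𝒜 𝒜 f = f ∘ₗ (cumulantMap 𝒜).toLinearMap := by
  ext1 x; simp [transport]

theorem transport_comp_symm (f : SymCoalg 𝒜 →ₗ[ℂ] SymCoalg 𝒜) :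
    transport 𝒜 𝒜 f ∘ₗ (cumulantMap 𝒜).symm.toLinearMap =
      (cumulantMap 𝒜).symm.toLinearMap ∘ₗ f := by
  ext1 x; simp [transport]

end SymCoalg

theorem IsCoalgHom.comp {V₁ V₂ V₃ : Type*} [AddCommGroup V₁] [Module ℂ V₁] [AddCommGroup V₂]
    [Module ℂ V₂] [AddCommGroup V₃] [Module ℂ V₃] {𝒱₁ : ℤ → Submodule ℂ V₁}
    {𝒱₂ : ℤ → Submodule ℂ V₂} {𝒱₃ : ℤ → Submodule ℂ V₃} [DirectSum.Decomposition 𝒱₁]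
    [DirectSum.Decomposition 𝒱₂] [DirectSum.Decomposition 𝒱₃] {G : SymCoalg 𝒱₂ →ₗ[ℂ] SymCoalg 𝒱₃}
    {F : SymCoalg 𝒱₁ →ₗ[ℂ] SymCoalg 𝒱₂} (hG : IsCoalgHom 𝒱₂ 𝒱₃ G) (hF : IsCoalgHom 𝒱₁ 𝒱₂ F) :
    IsCoalgHom 𝒱₁ 𝒱₃ (G ∘ₗ F) := by
  rw [IsCoalgHom, ← LinearMap.comp_assoc, hG, LinearMap.comp_assoc, hF, TensorProduct.map_comp,
    LinearMap.comp_assoc]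

namespace AffineHomotopy

variable {V : Type*} [AddCommGroup V] [Module ℂ V] {𝒱 : ℤ → Submodule ℂ V}
  [DirectSum.Decomposition 𝒱] {M : Type*} [AddCommGroup M] [Module ℂ M]
  (h : AffineHomotopy 𝒱 (GSym (trivialGrading M)))

/-- The map of coalgebras `S M → S V ⊗ ℂ[t, dt]` over `ℂ[t, dt]` with a given component. -/
def coalgHom : SymCoalg (trivialGrading M) →ₗ[ℂ] SymCoalg 𝒱 ⊗[ℂ] Forms :=
  SymForms.reduce 𝒱 ∘ₗ h.lift ∘ₗ GSym.duplicate M ∘ₗ Submodule.subtype _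

theorem coalgHom_reduce (x : GSym (trivialGrading M)) :
    h.coalgHom (SymCoalg.reduce _ x) = SymForms.reduce 𝒱 (h.lift (GSym.duplicate M x)) := by
  simp [coalgHom, SymCoalg.coe_reduce, SymForms.reduce]

theorem comul_coalgHom : SymForms.comul 𝒱 ∘ₗ h.coalgHom = SymForms.toRelTensor 𝒱 ∘ₗ
    TensorProduct.map h.coalgHom h.coalgHom ∘ₗ SymCoalg.comul (trivialGrading M) := by
  ext1 x
  have e1 := LinearMap.congr_fun (SymForms.comul_comp_reduce 𝒱) (h.lift (GSym.duplicate M x))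
  have e2 := LinearMap.congr_fun h.comul_lift (GSym.duplicate M x)
  have e3 := LinearMap.congr_fun (GSym.comul_duplicate M) x
  simp only [LinearMap.comp_apply] at e1 e2 e3
  have hW : TensorProduct.map h.lift h.lift (TensorProduct.map (GSym.duplicate M)
      (GSym.duplicate M) (GSym.comul (trivialGrading M) x)) ∈ GSymForms.degreeZeroTensors 𝒱 := by
    generalize GSym.comul (trivialGrading M) x = y
    induction y using TensorProduct.induction_on with
    | zero => simp
    | add a b ha hb => simp only [map_add]; exact add_mem ha hb
    | tmul a b => exact Submodule.apply_mem_map₂ _ (h.lift_mem _) (h.lift_mem _)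
  have e4 : h.coalgHom ∘ₗ SymCoalg.reduce _ = SymForms.reduce 𝒱 ∘ₗ h.lift ∘ₗ GSym.duplicate M :=
    LinearMap.ext h.coalgHom_reduce
  simp only [LinearMap.comp_apply, SymCoalg.comul, Submodule.subtype_apply]
  rw [TensorProduct.map_map, e4, TensorProduct.map_comp, LinearMap.comp_apply,
    TensorProduct.map_comp h.lift, LinearMap.comp_apply, SymForms.toRelTensor_reduce 𝒱 hW, ← e3, ← e2]
  exact e1

theorem coalgHom_mem {ψ : SymCoalg 𝒱 →ₗ[ℂ] SymCoalg 𝒱}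
    (hψ : ∀ k, ∀ x ∈ SymCoalg.degree 𝒱 k, ψ x ∈ SymCoalg.degree 𝒱 k) (k : ℤ)
    (x : SymCoalg (trivialGrading M)) (hx : x ∈ SymCoalg.degree (trivialGrading M) k) :
    TensorProduct.map ψ LinearMap.id (h.coalgHom x) ∈ SymForms.degree 𝒱 k := by
  by_cases hk : k = 0
  · subst hk
    exact SymForms.map_reduce_mem_degree 𝒱 hψ (h.lift_mem _)
  · have : x = 0 := Subtype.ext (GSym.eq_zero_of_mem_degree_trivialGrading M hk hx)
    rw [this, map_zero, map_zero]
    exact zero_mem _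

theorem eval_coalgHom (c : ℂ) : SymForms.eval 𝒱 c ∘ₗ h.coalgHom = SymCoalg.reduce 𝒱 ∘ₗ
    ((GSym.map _ 𝒱 (h.base + c • h.slope) (h.eval_mem c)).toLinearMap ∘ₗ GSym.duplicate M) ∘ₗ
      Submodule.subtype _ := by
  ext1 x
  simp only [LinearMap.comp_apply, coalgHom, SymForms.eval_reduce, eval_lift,
    AlgHom.toLinearMap_apply]

theorem isCoalgHom_eval (c : ℂ) :
    IsCoalgHom (trivialGrading M) 𝒱 (SymForms.eval 𝒱 c ∘ₗ h.coalgHom) := by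
  rw [eval_coalgHom]
  apply SymCoalg.isCoalgHom_of_comul
  · simp
  · rw [← LinearMap.comp_assoc, GSym.comul_map, LinearMap.comp_assoc, GSym.comul_duplicate,
      ← LinearMap.comp_assoc, TensorProduct.map_comp]

theorem proj_eval (c : ℂ) (x : SymCoalg (trivialGrading M)) :
    SymCoalg.proj 𝒱 (SymForms.eval 𝒱 c (h.coalgHom x)) = h.base x + c • h.slope x := by
  have := LinearMap.congr_fun (h.eval_coalgHom c) x
  have hx : GSym.counit (trivialGrading M) (x : GSym (trivialGrading M)) = 0 := x.2
  simp only [LinearMap.comp_apply] at this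
  rw [this, SymCoalg.proj_reduce, AlgHom.toLinearMap_apply, GSym.proj_map,
    Submodule.subtype_apply, GSym.proj_duplicate, hx, zero_smul, sub_zero]
  rfl

end AffineHomotopy

namespace Forms

/-- The integral of a form over `[0, 1]`. -/
def integral : Forms →ₗ[ℂ] ℂ where
  toFun ω := Polynomial.lsum (fun n : ℕ => ((n + 1 : ℂ)⁻¹) • LinearMap.id) ω.snd
  map_add' ω η := by rw [TrivSqZeroExt.snd_add, map_add]
  map_smul' c ω := by rw [TrivSqZeroExt.snd_smul, map_smul]; rfl

theorem integral_d (ω : Forms) : integral (d ω) = eval 1 ω - eval 0 ω := by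
  change Polynomial.lsum (fun n : ℕ => ((n + 1 : ℂ)⁻¹) • LinearMap.id)
    (Polynomial.derivative ω.fst) = ω.fst.eval 1 - ω.fst.eval 0
  induction ω.fst using Polynomial.induction_on' with
  | add p q hp hq => simp only [map_add, hp, hq, Polynomial.eval_add]; ring
  | monomial n a =>
    rw [Polynomial.derivative_monomial, Polynomial.lsum_apply, Polynomial.sum_monomial_index _ _ (by simp)]
    cases n with
    | zero => simp
    | succ n =>
      have : (n + 1 : ℂ) ≠ 0 := by exact_mod_cast n.succ_ne_zero
      simp
      field_simp

end Forms

namespace ProbabilitySpace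

variable {A : Type*} [Ring A] [Algebra ℂ A] {𝒜 : ℤ → Submodule ℂ A} [GradedAlgebra 𝒜]
  [GradedCommutative 𝒜] (P : ProbabilitySpace 𝒜)

/-- The coalgebra map `S A → S ℂ` induced by the expectation. -/
def symExpectation : SymCoalg 𝒜 →ₗ[ℂ] SymCoalg (trivialGrading ℂ) :=
  SymCoalg.map 𝒜 (trivialGrading ℂ) P.expectation P.expectation_mem

theorem symExpectation_extend (x : SymCoalg 𝒜) : P.symExpectation (SymCoalg.extend 𝒜 P.d x) = 0 :=
  Subtype.ext (GSym.map_coderiv_eq_zero 𝒜 _ _ P.expectation_mem P.d_mem P.expectation_comp_d x)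

theorem symExpectation_parity (x : SymCoalg 𝒜) :
    P.symExpectation (SymCoalg.parity 𝒜 x) = P.symExpectation x := by
  apply Subtype.ext
  have := GSym.signTwist_map 𝒜 (trivialGrading ℂ) P.expectation P.expectation_mem 1 x
  rw [GSym.signTwist_trivialGrading] at this
  exact this.symm

theorem proj_symExpectation (x : SymCoalg 𝒜) :
    SymCoalg.proj _ (P.symExpectation x) = P.expectation (SymCoalg.proj 𝒜 x) :=
  GSym.proj_map 𝒜 (trivialGrading ℂ) P.expectation P.expectation_mem x

/-- Stokes' theorem for the expectation integrated over `[0, 1]`. -/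
theorem symExpectation_eval_sub (w : SymCoalg 𝒜 ⊗[ℂ] Forms) :
    P.symExpectation (SymForms.eval 𝒜 1 w) - P.symExpectation (SymForms.eval 𝒜 0 w) =
      TensorProduct.rid ℂ _ (TensorProduct.map P.symExpectation Forms.integral
        (SymForms.differential 𝒜 (SymCoalg.extend 𝒜 P.d) w)) := by
  induction w using TensorProduct.induction_on with
  | zero => simp
  | add a b ha hb => simp only [map_add, ← ha, ← hb]; abel
  | tmul x ω =>
    simp [SymForms.eval, SymForms.differential, symExpectation_extend, symExpectation_parity,
      Forms.integral_d, sub_smul]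

theorem jointCumulant_eq_iff {n : ℕ} (X Y : P.Collection n) :
    X.jointCumulant = Y.jointCumulant ↔ ∀ c,
      P.symExpectation (SymCoalg.cumulantMap 𝒜 (X.toLinearMap c)) =
      P.symExpectation (SymCoalg.cumulantMap 𝒜 (Y.toLinearMap c)) := by
  rw [LinearMap.ext_iff]
  refine forall_congr' fun c => ?_
  exact (SymCoalg.cumulantMap (trivialGrading ℂ)).symm.injective.eq_iff

theorem jointCumulant_eq_of_homotopic {n : ℕ} {X Y : P.Collection n} (h : X.Homotopic Y) :
    X.jointCumulant = Y.jointCumulant := by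
  obtain ⟨H, hH, h0, h1⟩ := h
  rw [jointCumulant_eq_iff]
  intro c
  have hD := LinearMap.congr_fun (SymForms.differential_map
    (LinearMap.ext (SymCoalg.parity_cumulantMap 𝒜))
    (SymCoalg.cumulantMap_comp_transport 𝒜 (SymCoalg.extend 𝒜 P.d)).symm) (H c)
  have hc : SymForms.differential 𝒜 P.transportedStructure (H c) = 0 := by
    simpa using LinearMap.congr_fun hH.comm c
  have hev : ∀ t, SymForms.eval 𝒜 t
      (TensorProduct.map (SymCoalg.cumulantMap 𝒜).toLinearMap LinearMap.id (H c)) =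
      SymCoalg.cumulantMap 𝒜 (SymForms.eval 𝒜 t (H c)) :=
    fun t => LinearMap.congr_fun (SymForms.eval_map t) (H c)
  simp only [LinearMap.comp_apply] at hD
  have key := P.symExpectation_eval_sub
    (TensorProduct.map (SymCoalg.cumulantMap 𝒜).toLinearMap LinearMap.id (H c))
  rw [hD, ← transportedStructure, hc, map_zero, map_zero, map_zero, hev, hev] at key
  rw [← h0, ← h1]
  exact (sub_eq_zero.1 key).symm

variable {P}

/-- The component of the moments `S (Cⁿ) → A` of a collection. -/
def Collection.component {n : ℕ} (X : P.Collection n) : GSym (trivialGrading (Fin n → ℂ)) →ₗ[ℂ] A :=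
  SymCoalg.proj 𝒜 ∘ₗ (SymCoalg.cumulantMap 𝒜).toLinearMap ∘ₗ X.toLinearMap ∘ₗ SymCoalg.reduce _

theorem Collection.component_coe {n : ℕ} (X : P.Collection n)
    (c : SymCoalg (trivialGrading (Fin n → ℂ))) :
    X.component c = SymCoalg.proj 𝒜 (SymCoalg.cumulantMap 𝒜 (X.toLinearMap c)) := by
  simp [component]

theorem Collection.component_mem {n : ℕ} (X : P.Collection n)
    (c : GSym (trivialGrading (Fin n → ℂ))) : X.component c ∈ 𝒜 0 := by
  refine GSym.proj_mem 𝒜 (SymCoalg.cumulantMap_mem_degree 𝒜 (X.isLInfinityMorphism.degree_zero 0 _ ?_))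
  change (SymCoalg.reduce _ c : GSym (trivialGrading (Fin n → ℂ))) ∈ GSym.degree _ 0
  rw [GSym.degree_trivialGrading_zero]
  trivial

theorem Collection.d_component {n : ℕ} (X : P.Collection n)
    (c : GSym (trivialGrading (Fin n → ℂ))) : P.d (X.component c) = 0 := by
  have h1 := LinearMap.congr_fun X.isLInfinityMorphism.comm (SymCoalg.reduce _ c)
  have h2 := LinearMap.congr_fun (SymCoalg.cumulantMap_comp_transport 𝒜 (SymCoalg.extend 𝒜 P.d))
    (X.toLinearMap (SymCoalg.reduce _ c))
  simp only [LinearMap.comp_apply, LinearMap.zero_apply, map_zero] at h1 h2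
  rw [← transportedStructure, h1, map_zero] at h2
  have h3 := GSym.proj_coderiv 𝒜 P.d_mem
    (SymCoalg.cumulantMap 𝒜 (X.toLinearMap (SymCoalg.reduce _ c)) : GSym 𝒜)
  refine h3.symm.trans ?_
  have h4 := congrArg (SymCoalg.proj 𝒜) h2.symm
  rw [map_zero] at h4
  exact h4

/-- In a contractible space, closed elements of expectation zero are exact. -/
theorem IsContractible.mem_range (hP : P.IsContractible) {a : A} (hd : P.d a = 0)
    (hE : P.expectation a = 0) : a ∈ LinearMap.range P.d := by
  have h0 : P.expectation ∘ₗ P.d = (0 : ℂ →ₗ[ℂ] ℂ) ∘ₗ P.expectation := by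
    rw [P.expectation_comp_d, LinearMap.zero_comp]
  have := hP.1.eq_iff (a := Submodule.Quotient.mk ⟨a, hd⟩) (b := 0)
  have h1 : Cohomology.map P.expectation h0 (Submodule.Quotient.mk ⟨a, hd⟩) = 0 := by
    refine (Submodule.Quotient.mk_eq_zero _).2 ?_
    change P.expectation a ∈ LinearMap.range (0 : ℂ →ₗ[ℂ] ℂ)
    rw [hE]; exact zero_mem _
  rw [map_zero] at this
  exact (Submodule.Quotient.mk_eq_zero ((LinearMap.range P.d).submoduleOf _)).1 (this.1 h1)

/-- In a contractible space, a linear map to closed elements of degree zero and expectation zero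
has a primitive of degree `-1`. -/
theorem IsContractible.exists_primitive (hP : P.IsContractible) {N : Type*} [AddCommGroup N]
    [Module ℂ N] (f : N →ₗ[ℂ] A) (hf : ∀ c, f c ∈ 𝒜 0) (hd : ∀ c, P.d (f c) = 0)
    (hE : ∀ c, P.expectation (f c) = 0) :
    ∃ s : N →ₗ[ℂ] A, (∀ c, s c ∈ 𝒜 (-1)) ∧ ∀ c, P.d (s c) = f c := by
  obtain ⟨g, hg⟩ := P.d.rangeRestrict.exists_rightInverse_of_surjective
    (LinearMap.range_rangeRestrict P.d)
  have hπ : ∀ a, P.d (GradedRing.proj 𝒜 (-1) a) = GradedRing.proj 𝒜 0 (P.d a) := by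
    intro a
    induction a using DirectSum.Decomposition.inductionOn 𝒜 with
    | zero => simp
    | add a b ha hb => simp only [map_add, ha, hb]
    | @homogeneous i m =>
      rw [GradedRing.proj_apply, GradedRing.proj_apply,
        DirectSum.decompose_of_mem 𝒜 (P.d_mem i m m.2), DirectSum.decompose_coe,
        DirectSum.coe_of_apply, DirectSum.coe_of_apply]
      by_cases hi : i = -1
      · subst hi; simp
      · rw [if_neg hi, if_neg (by omega)]; simp
  refine ⟨{ toFun := fun a => GradedRing.proj 𝒜 (-1) a
            map_add' := map_add _
            map_smul' := fun c a => by
              rw [GradedRing.proj_apply, DirectSum.decompose_smul]; rfl } ∘ₗ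
    g ∘ₗ f.codRestrict (LinearMap.range P.d) (fun c => hP.mem_range (hd c) (hE c)), ?_, ?_⟩
  · intro c
    exact SetLike.coe_mem _
  · intro c
    refine (hπ _).trans ?_
    have h1 := congrArg Subtype.val (LinearMap.congr_fun hg
      (f.codRestrict (LinearMap.range P.d) (fun c => hP.mem_range (hd c) (hE c)) c))
    change P.d (g _) = f c at h1
    simp only [LinearMap.comp_apply]
    rw [h1, GradedRing.proj_apply, DirectSum.decompose_of_mem_same 𝒜 (hf c)]

theorem IsContractible.homotopic (hP : P.IsContractible) {n : ℕ} {X Y : P.Collection n}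
    (h : X.jointCumulant = Y.jointCumulant) : X.Homotopic Y := by
  rw [jointCumulant_eq_iff] at h
  have hE : ∀ c, P.expectation (X.component c) = P.expectation (Y.component c) := by
    intro c
    have := congrArg (SymCoalg.proj _) (h (SymCoalg.reduce _ c))
    rwa [proj_symExpectation, proj_symExpectation] at this
  obtain ⟨s, hs, hds⟩ := hP.exists_primitive (X.component - Y.component)
    (fun c => sub_mem (X.component_mem c) (Y.component_mem c))
    (fun c => by rw [LinearMap.sub_apply, map_sub, X.d_component, Y.d_component, sub_zero])
    (fun c => by rw [LinearMap.sub_apply, map_sub, hE, sub_self])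
  let T : AffineHomotopy 𝒜 (GSym (trivialGrading (Fin n → ℂ))) :=
    { base := X.component
      slope := Y.component - X.component
      form := s
      base_mem := X.component_mem
      slope_mem := fun c => sub_mem (Y.component_mem c) (X.component_mem c)
      form_mem := hs }
  have hT := T.differential_lift P.d_mem X.d_component
    (fun c => by rw [hds, LinearMap.sub_apply, LinearMap.sub_apply, neg_sub])
    (fun c => by rw [LinearMap.sub_apply, map_sub, X.d_component, Y.d_component, sub_zero])
  have hpar : SymCoalg.parity 𝒜 ∘ₗ (SymCoalg.cumulantMap 𝒜).symm.toLinearMap =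
      (SymCoalg.cumulantMap 𝒜).symm.toLinearMap ∘ₗ SymCoalg.parity 𝒜 :=
    LinearMap.ext (SymCoalg.parity_cumulantMap_symm 𝒜)
  have heval : ∀ (Z : P.Collection n) (t : ℂ), T.base + t • T.slope = Z.component →
      SymForms.eval 𝒜 t ∘ₗ TensorProduct.map (SymCoalg.cumulantMap 𝒜).symm.toLinearMap LinearMap.id ∘ₗ
        T.coalgHom = Z.toLinearMap := by
    intro Z t hZ
    have : SymForms.eval 𝒜 t ∘ₗ T.coalgHom =
        (SymCoalg.cumulantMap 𝒜).toLinearMap ∘ₗ Z.toLinearMap := by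
      apply IsCoalgHom.ext (trivialGrading (Fin n → ℂ)) 𝒜 (T.isCoalgHom_eval t)
        ((SymCoalg.isCoalgHom_cumulantMap 𝒜).comp Z.isLInfinityMorphism.coalg)
      ext1 c
      exact (T.proj_eval t c).trans ((LinearMap.congr_fun hZ _).trans (Z.component_coe c))
    rw [← LinearMap.comp_assoc, SymForms.eval_map, LinearMap.comp_assoc, this]
    ext1 c
    simp
  refine ⟨TensorProduct.map (SymCoalg.cumulantMap 𝒜).symm.toLinearMap LinearMap.id ∘ₗ T.coalgHom,
    ⟨?_, ?_, ?_⟩, ?_, ?_⟩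
  · rw [← LinearMap.comp_assoc, SymForms.comul_map (SymCoalg.isCoalgHom_cumulantMap_symm 𝒜),
      LinearMap.comp_assoc, T.comul_coalgHom, ← LinearMap.comp_assoc, ← SymForms.toRelTensor_map hpar,
      TensorProduct.map_comp]
    rfl
  · intro k x hx
    exact T.coalgHom_mem (fun k x => SymCoalg.cumulantMap_symm_mem_degree 𝒜) k x hx
  · rw [← LinearMap.comp_assoc, transportedStructure, SymForms.differential_map hpar
      (SymCoalg.transport_comp_symm 𝒜 _), LinearMap.comp_assoc, AffineHomotopy.coalgHom,
      ← LinearMap.comp_assoc _ _ (SymForms.differential 𝒜 _), SymForms.differential_reduce,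
      LinearMap.comp_assoc, ← LinearMap.comp_assoc _ _ (GSymForms.differential 𝒜 _), hT]
    simp
  · exact heval X 0 (by simp [T])
  · exact heval Y 1 (by simp [T])

end ProbabilitySpace

end HPT

end

theorem proposition3p2 {V : Type*} [Ring V] [Algebra ℂ V] (𝒱 : ℤ → Submodule ℂ V)
    [GradedAlgebra 𝒱] [HPT.GradedCommutative 𝒱] (P : HPT.ProbabilitySpace 𝒱)
    (hP : P.IsContractible) (n : ℕ) (X Y : P.Collection n) :
    X.Homotopic Y ↔ X.jointCumulant = Y.jointCumulant :=
  ⟨P.jointCumulant_eq_of_homotopic, hP.homotopic⟩
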